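/- Setting. Let $\mathcal X$ be a measurable space, let $\mathcal D$ be a probability distribution on $\mathcal X\times\{\pm1\}$, and let $K_1,\dots,K_p:\mathcal X\times\mathcal X\to\mathbb R$ be measurable Mercer (symmetric positive semidefinite) kernels with $K_i(x,x')\le\kappa_i^2$ for all $x,x'\in\mathcal X$, where $\kappa_i>0$. Write $\boldsymbol\kappa=(\kappa_1^2,\dots,\kappa_p^2)$, $[t]_+=\max(t,0)$, and, for $\mu\in\mathbb R^p$ with $\mu\ge0$ (entrywise), $K_\mu=\sum_{i=1}^p\mu_iK_i$. A Mercer kernel $K$ with reproducing kernel Hilbert space $\mathcal H_K$ and feature map $\Phi_K$ is called *$(\epsilon,\gamma)$-kernel good* if there is $w\in\mathcal H_K$ with $\|w\|_{\mathcal H_K}=1$ and $\mathbb E_{(x,y)\sim\mathcal D}\big[1-y\langle w,\Phi_K(x)\rangle/\gamma\big]_+\le\epsilon$. It is called *at least $(\epsilon,\gamma)$-kernel good* if it is $(\epsilon,\gamma')$-kernel good for some $\gamma'\ge\gamma$. The risk of $\mu$ is $$\mathcal R(\mu)=\mathbb E_{(x,y),(x',y')\sim\mathcal D\times\mathcal D}\,[1-yy'K_\mu(x,x')]_+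 ,$$ and $\mu$ is *$\epsilon$-combination good* if $\mathcal R(\mu)\le\epsilon$. For a sample $(x_1,y_1),\dots,(x_n,y_n)$ drawn i.i.d. from $\mathcal D$, let $$\hat{\mathcal R}(\mu)=\frac{2}{n(n-1)}\sum_{1\le i<j\le n}[1-y_iy_jK_\mu(x_i,x_j)]_+ .$$ Theorem (oracle inequality, $L_2$ case). For every $\delta_0\in(0,1)$ there is a constant $C>0$, depending only on $\delta_0$, such that the following holds for every such setting. Let $\mu_o\ge0$, $\mu_o\ne0$, be $\epsilon_o$-combination good, let $\epsilon_1>0$ and $0<\delta\le\delta_0$, put $\lambda=\dfrac{2\epsilon_1}{3\|\mu_o\|_2^2}$, and let $$n\ \ge\ C\,\frac{\|\mu_o\|_2^2\,\|\boldsymbol\kappa\|_2^2\,\log(1/\delta)}{\epsilon_1^3}.$$ Then for every sample the problem $\min_{\mu\ge0}\ \frac\lambda2\|\mu\|_2^2+\hat{\mathcal R}(\mu)$ has exactly one minimizer $\hat\mu$, and with probability at least $1-\delta$ over the sample the kernel $K_{\hat\mu}$ is at least $$\left(\epsilon_o+\epsilon_1,\ \frac{1}{\|\boldsymbol\kappa\|_2\,\|\mu_o\|_2}\sqrt{\frac{\epsilon_1}{3}}\right)\text{-kernel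 good},$$ where, only if $\epsilon_o+\epsilon_1\ge1$, the samples with $K_{\hat\mu}\equiv0$ are left out of this claim (the Hilbert space of the zero kernel has no unit vector). -/

import Mathlib

open MeasureTheory

noncomputable section

namespace TwoStageMKL

/-- The labels `{1, -1}`. -/
abbrev Label : Type := {y : ℝ // y = 1 ∨ y = -1}

/-- A Mercer kernel on `X`: a real-valued symmetric positive semidefinite kernel. -/
def IsMercer {X : Type*} (K : X → X → ℝ) : Prop :=
  (Matrix.of K).PosSemidef

/-- The kernel `K`, each value being viewed as a multiplication operator on `ℝ`; this is the form
of a scalar kernel that Mathlib's reproducing kernel Hilbert spaces use. -/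
def operatorKernel {X : Type*} (K : X → X → ℝ) : Matrix X X (ℝ →L[ℝ] ℝ) :=
  Matrix.of fun x x' => K x x' • ContinuousLinearMap.id ℝ ℝ

theorem IsMercer.posSemidef_operatorKernel {X : Type*} {K : X → X → ℝ} (hK : IsMercer K) :
    (operatorKernel K).PosSemidef := by
  have key := (RKHS.posSemidef_tfae (K := operatorKernel K)).out 0 2
  refine key.mpr ⟨?_, fun v => ?_⟩
  · ext x y
    have h := hK.1.apply x y
    simp only [Matrix.of_apply, star_trivial] at h
    have h1 : star (ContinuousLinearMap.id ℝ ℝ) = ContinuousLinearMap.id ℝ ℝ := star_one _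
    simp [operatorKernel, Matrix.conjTranspose_apply, h, h1]
  · have h := hK.2 v
    simp only [Matrix.of_apply, star_trivial] at h
    rw [Finsupp.sum_comm] at h
    simp only [operatorKernel, Matrix.of_apply, RCLike.re_to_real]
    convert! h using 3
    simp [mul_comm, mul_left_comm]

instance {X : Type*} {K : X → X → ℝ} [hK : Fact (IsMercer K)] :
    Fact (operatorKernel K).PosSemidef :=
  ⟨hK.out.posSemidef_operatorKernel⟩

/-- The reproducing kernel Hilbert space `H_K` of the Mercer kernel `K`. -/
abbrev HilbertSpace {X : Type*} (K : X → X → ℝ) [Fact (IsMercer K)] : Type _ :=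
  RKHS.OfKernel (operatorKernel K)

/-- The feature map `Φ_K : X → H_K`, `x ↦ K(·, x)`. -/
def featureMap {X : Type*} (K : X → X → ℝ) [Fact (IsMercer K)] (x : X) : HilbertSpace K :=
  RKHS.kerFun (HilbertSpace K) x (1 : ℝ)

/-- The feature map reproduces the kernel. -/
theorem inner_featureMap {X : Type*} (K : X → X → ℝ) [Fact (IsMercer K)] (x x' : X) :
    inner ℝ (featureMap K x) (featureMap K x') = K x x' := by
  rw [featureMap, featureMap, RKHS.kerFun_inner, RKHS.kerFun_apply, RKHS.OfKernel.kernel_ofKernel]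
  simp [operatorKernel]

/-- The positive part `[t]₊`. -/
def plusPart (t : ℝ) : ℝ := max t 0

/-- `K` is `(ε, γ)`-kernel good for the distribution `D`: it is a Mercer kernel and there is a unit
vector `w` of its reproducing kernel Hilbert space with
`E_{(x, y) ∼ D} [1 - y ⟨w, Φ(x)⟩ / γ]₊ ≤ ε`. -/
def KernelGood {X : Type*} [MeasurableSpace X] (D : Measure (X × Label)) (K : X → X → ℝ)
    (ε γ : ℝ) : Prop :=
  ∃ hK : IsMercer K,
    haveI : Fact (IsMercer K) := ⟨hK⟩
    ∃ w : HilbertSpace K, ‖w‖ = 1 ∧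
      Integrable (fun z : X × Label => plusPart (1 - z.2 * inner ℝ w (featureMap K z.1) / γ)) D ∧
      ∫ z, plusPart (1 - z.2 * inner ℝ w (featureMap K z.1) / γ) ∂D ≤ ε

/-- The combination `K_μ = ∑ i, μ i * K i`. -/
def combination {X : Type*} {p : ℕ} (K : Fin p → X → X → ℝ) (μ : EuclideanSpace ℝ (Fin p))
    (x x' : X) : ℝ :=
  ∑ i, μ i * K i x x'

/-- The pairwise loss `[1 - y y' K_μ(x, x')]₊`. -/
def pairLoss {X : Type*} {p : ℕ} (K : Fin p → X → X → ℝ) (μ : EuclideanSpace ℝ (Fin p))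
    (z z' : X × Label) : ℝ :=
  plusPart (1 - z.2 * z'.2 * combination K μ z.1 z'.1)

/-- The risk `R(μ) = E_{z, z' ∼ D × D} [1 - y y' K_μ(x, x')]₊`. -/
def risk {X : Type*} [MeasurableSpace X] {p : ℕ} (D : Measure (X × Label))
    (K : Fin p → X → X → ℝ) (μ : EuclideanSpace ℝ (Fin p)) : ℝ :=
  ∫ q : (X × Label) × (X × Label), pairLoss K μ q.1 q.2 ∂(D.prod D)

/-- `μ` is `ε`-combination good: `R(μ) ≤ ε`. -/
def CombinationGood {X : Type*} [MeasurableSpace X] {p : ℕ} (D : Measure (X × Label))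
    (K : Fin p → X → X → ℝ) (μ : EuclideanSpace ℝ (Fin p)) (ε : ℝ) : Prop :=
  risk D K μ ≤ ε

/-- The empirical risk `2 / (n (n - 1)) * ∑_{i < j} [1 - y_i y_j K_μ(x_i, x_j)]₊` of the training
sample `S`. -/
def empiricalRisk {X : Type*} {p n : ℕ} (K : Fin p → X → X → ℝ) (S : Fin n → X × Label)
    (μ : EuclideanSpace ℝ (Fin p)) : ℝ :=
  2 / ((n : ℝ) * ((n : ℝ) - 1)) *
    ∑ i : Fin n, ∑ j : Fin n with i < j, pairLoss K μ (S i) (S j)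

/-- The objective `λ / 2 * ‖μ‖₂² + R̂(μ)`. -/
def objective {X : Type*} {p n : ℕ} (K : Fin p → X → X → ℝ) (lam : ℝ) (S : Fin n → X × Label)
    (μ : EuclideanSpace ℝ (Fin p)) : ℝ :=
  lam / 2 * ‖μ‖ ^ 2 + empiricalRisk K S μ

/-- `μ` is a learned combination for `S`: a minimizer of the objective over all vectors with
nonnegative entries. -/
def IsLearned {X : Type*} {p n : ℕ} (K : Fin p → X → X → ℝ) (lam : ℝ) (S : Fin n → X × Label)
    (μ : EuclideanSpace ℝ (Fin p)) : Prop :=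
  (∀ i, 0 ≤ μ i) ∧
    ∀ ν : EuclideanSpace ℝ (Fin p), (∀ i, 0 ≤ ν i) → objective K lam S μ ≤ objective K lam S ν

/-- The vector `(κ₁², …, κ_p²)` of kernel bounds. -/
def boundVec {p : ℕ} (κ : Fin p → ℝ) : EuclideanSpace ℝ (Fin p) :=
  WithLp.toLp 2 fun i => κ i ^ 2

end TwoStageMKL

end

/-!
The oracle inequality follows from three facts.

*Uniform convergence.* The learned combination has objective at most that of the zero vector, so it
lies in the ball of radius `B = ‖μo‖ √(3 / ε₁)`. On this ball risk and empirical risk differ by at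
most `ε₁ / 3`, in both directions, with high probability (`exists_measurableSet_risk_deviation`).
The pairwise loss is a contraction of the linear class `μ ↦ ⟪μ, v⟫`, where `v` is the vector of
labelled kernel values, of norm at most `‖κ‖`; hence the deviation depends on `B ‖κ‖` only, and not
on the number of kernels. Instead of bounding a Rademacher complexity and applying a
bounded-differences inequality, the exponential moment of the supremum is estimated in one
induction on the sample size (`lintegral_exp_sup'_sum_centered_le`): each variable in turn is
symmetrized and contracted to a linear term (`integral_exp_sup'_centered_le`), and Pinelis'
inequality for `cosh ‖a ± v‖` closes the induction (`cosh_norm_add_add_cosh_norm_sub_le`). The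
pairs of a sample are not independent, but the empirical risk is an average, over permutations of
the sample, of means over disjoint pairs (`pair_mean_eq_perm_mean`), and exponential moments are
convex.

*Comparison of objectives.* As `λ / 2 * ‖μo‖ ^ 2 = ε₁ / 3`, minimality and the two deviation bounds
give `R(μ) ≤ R(μo) + ε₁` for the learned `μ` (`IsLearned.risk_le`).

*From risk to margin.* If `w = E [y Φ(x)]` in the Hilbert space of `K_μ`, then
`y ⟪w, Φ(x)⟫ = E' [y y' K_μ(x, x')]`, so Jensen's inequality bounds the hinge loss of `w` by `R(μ)`;
moreover `‖w‖ ^ 2 = E [y y' K_μ(x, x')] ≤ B ‖κ‖` (`exists_kernelGood_of_risk_le`). The margin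
`1 / ‖w‖` is large enough unless `B ‖κ‖ < 1`; in that case the loss is affine and the claim can be
checked directly.

If `εo + ε₁ ≥ 1`, a unit vector that correlates nonnegatively with the labels, at a large margin, is
enough (`exists_kernelGood_of_one_le`). If `εo + ε₁ < 1`, then `ε₁ < ‖μo‖ ‖κ‖` because
`R(μo) ≥ 1 - ‖μo‖ ‖κ‖`, and the bound on `n` excludes samples with fewer than two points.
-/

namespace TwoStageMKL

/-! ### Exponential moments of uniform deviations -/

section ExponentialMoment

/-- The inequality behind the contraction principle for the exponential function, for two points at
which the suprema on the left are attained. Depending on signs and order of `s` and `t`, it holds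
termwise or because `exp` has larger increments further to the right. -/
theorem exp_add_exp_le_of_contraction {a b p q s t : ℝ} (hp : |p| ≤ |s|) (hq : |q| ≤ |t|)
    (hpq : |p - q| ≤ |s - t|) (h₁ : b + q ≤ a + p) (h₂ : a - p ≤ b - q) :
    Real.exp (a + p) + Real.exp (b - q) ≤
      max (Real.exp (a + s) + Real.exp (b - t)) (Real.exp (b + t) + Real.exp (a - s)) := by
  have key : ∀ x y d e : ℝ, x ≤ y → 0 ≤ d → d ≤ e →
      Real.exp (x + d) - Real.exp x ≤ Real.exp (y + e) - Real.exp y := by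
    intro x y d e hxy hd hde
    rw [Real.exp_add, Real.exp_add]
    have h1 := Real.exp_le_exp.2 hxy
    have h2 := Real.exp_le_exp.2 hde
    have h3 := Real.one_le_exp hd
    have h4 := Real.exp_pos x
    nlinarith
  rw [abs_le] at hp hq hpq
  rcases le_total 0 s with hs | hs <;> rcases le_total 0 t with ht | ht
  · rw [abs_of_nonneg hs] at hp
    rw [abs_of_nonneg ht] at hq
    rcases le_total s t with hst | hst
    · rw [abs_of_nonpos (by linarith)] at hpq
      have := key (a - s) (b - q) (s + p) (t + q) (by linarith) (by linarith) (by linarith)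
      rw [show a - s + (s + p) = a + p by ring, show b - q + (t + q) = b + t by ring] at this
      exact le_max_of_le_right (by linarith)
    · rw [abs_of_nonneg (by linarith)] at hpq
      have := key (b - t) (a + p) (t - q) (s - p) (by linarith) (by linarith) (by linarith)
      rw [show b - t + (t - q) = b - q by ring, show a + p + (s - p) = a + s by ring] at this
      exact le_max_of_le_left (by linarith)
  · rw [abs_of_nonneg hs] at hp
    rw [abs_of_nonpos ht] at hq
    exact le_max_of_le_left
      (add_le_add (Real.exp_le_exp.2 (by linarith)) (Real.exp_le_exp.2 (by linarith)))
  · rw [abs_of_nonpos hs] at hp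
    rw [abs_of_nonneg ht] at hq
    refine le_max_of_le_right ?_
    rw [add_comm (Real.exp (b + t))]
    exact add_le_add (Real.exp_le_exp.2 (by linarith)) (Real.exp_le_exp.2 (by linarith))
  · rw [abs_of_nonpos hs] at hp
    rw [abs_of_nonpos ht] at hq
    rcases le_total s t with hst | hst
    · rw [abs_of_nonpos (by linarith)] at hpq
      have := key (b + t) (a + p) (-t - q) (-s - p) (by linarith) (by linarith) (by linarith)
      rw [show b + t + (-t - q) = b - q by ring, show a + p + (-s - p) = a - s by ring] at this
      exact le_max_of_le_right (by linarith)
    · rw [abs_of_nonneg (by linarith)] at hpq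
      have := key (a + s) (b - q) (-s + p) (-t + q) (by linarith) (by linarith) (by linarith)
      rw [show a + s + (-s + p) = a + p by ring, show b - q + (-t + q) = b - t by ring] at this
      exact le_max_of_le_left (by linarith)

variable {ι : Type*} {T : Finset ι} (hT : T.Nonempty)

/-- One coordinate of the Ledoux–Talagrand contraction principle, for the exponential function:
averaging over a random sign, a contraction `f` of `g` that vanishes where `g` does may be replaced
by `g` itself. -/
theorem exp_sup'_contraction (u f g : ι → ℝ) (hf : ∀ t ∈ T, |f t| ≤ |g t|)
    (hfg : ∀ s ∈ T, ∀ t ∈ T, |f s - f t| ≤ |g s - g t|) :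
    Real.exp (T.sup' hT fun t => u t + f t) + Real.exp (T.sup' hT fun t => u t - f t) ≤
      Real.exp (T.sup' hT fun t => u t + g t) + Real.exp (T.sup' hT fun t => u t - g t) := by
  obtain ⟨s, hs, hs'⟩ := T.exists_mem_eq_sup' hT (fun t => u t + f t)
  obtain ⟨t, ht, ht'⟩ := T.exists_mem_eq_sup' hT (fun t => u t - f t)
  have h₁ : u t + f t ≤ u s + f s := hs' ▸ T.le_sup' (fun t => u t + f t) ht
  have h₂ : u s - f s ≤ u t - f t := ht' ▸ T.le_sup' (fun t => u t - f t) hs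
  rw [hs', ht']
  refine (exp_add_exp_le_of_contraction (hf s hs) (hf t ht) (hfg s hs t ht) h₁ h₂).trans
    (max_le ?_ ?_) <;>
  exact add_le_add
    (Real.exp_le_exp.2 (T.le_sup' (fun t => u t + g t) (by assumption)))
    (Real.exp_le_exp.2 (T.le_sup' (fun t => u t - g t) (by assumption)))

theorem exp_sup'_le {u : ι → ℝ} {c : ℝ} (h : ∀ t ∈ T, Real.exp (u t) ≤ c) :
    Real.exp (T.sup' hT u) ≤ c := by
  obtain ⟨s, hs, hs'⟩ := T.exists_mem_eq_sup' hT u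
  rw [hs']
  exact h s hs

theorem exp_le_exp_sup' {u : ι → ℝ} {t : ι} (ht : t ∈ T) :
    Real.exp (u t) ≤ Real.exp (T.sup' hT u) :=
  Real.exp_le_exp.2 (T.le_sup' u ht)

theorem measurable_sup'_fun {Z : Type*} [MeasurableSpace Z] {f : ι → Z → ℝ}
    (hf : ∀ t ∈ T, Measurable (f t)) : Measurable fun z => T.sup' hT fun t => f t z := by
  have := Finset.measurable_sup' hT hf
  convert this using 1
  ext z
  rw [Finset.sup'_apply]

theorem integrable_exp_sup' {Z : Type*} [MeasurableSpace Z] {P : Measure Z} [IsFiniteMeasure P]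
    {f : ι → Z → ℝ} (hf : ∀ t ∈ T, Measurable (f t)) {c : ℝ} (hc : ∀ t ∈ T, ∀ z, f t z ≤ c) :
    Integrable (fun z => Real.exp (T.sup' hT fun t => f t z)) P := by
  refine Integrable.of_bound
    (Real.measurable_exp.comp (measurable_sup'_fun hT hf)).aestronglyMeasurable (Real.exp c)
    (Filter.Eventually.of_forall fun z => ?_)
  rw [Real.norm_eq_abs, abs_of_pos (Real.exp_pos _)]
  exact Real.exp_le_exp.2 (Finset.sup'_le _ _ fun t ht => hc t ht z)

/-- Symmetrization and contraction in one variable. The mean `∫ f` is replaced by a second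
copy of the variable (Jensen), the two copies are separated by the inequality between the geometric
and the arithmetic mean, and `f` is replaced by `g` through `exp_sup'_contraction`. -/
theorem integral_exp_sup'_centered_le {Z : Type*} [MeasurableSpace Z] {P : Measure Z}
    [IsProbabilityMeasure P] (u : ι → ℝ) {f g : ι → Z → ℝ} {c : ℝ}
    (hfm : ∀ t ∈ T, Measurable (f t)) (hgm : ∀ t ∈ T, Measurable (g t))
    (hgc : ∀ t ∈ T, ∀ z, |g t z| ≤ c) (hf : ∀ t ∈ T, ∀ z, |f t z| ≤ |g t z|)
    (hfg : ∀ s ∈ T, ∀ t ∈ T, ∀ z, |f s z - f t z| ≤ |g s z - g t z|) :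
    ∫ z, Real.exp (T.sup' hT fun t => u t + ((∫ z', f t z' ∂P) - f t z)) ∂P ≤
      ∫ z, (1 / 2) * (Real.exp (T.sup' hT fun t => u t + 2 * g t z) +
        Real.exp (T.sup' hT fun t => u t - 2 * g t z)) ∂P := by
  have hfc : ∀ t ∈ T, ∀ z, |f t z| ≤ c := fun t ht z => (hf t ht z).trans (hgc t ht z)
  have hfi : ∀ t ∈ T, Integrable (f t) P := fun t ht =>
    Integrable.of_bound (hfm t ht).aestronglyMeasurable c
      (Filter.Eventually.of_forall fun z => by simpa using hfc t ht z)
  set U := T.sup' hT u with hU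
  have huU : ∀ t ∈ T, u t ≤ U := fun t ht => T.le_sup' u ht
  -- integrability of the four exponentials involved
  have ip : ∀ h : ι → Z → ℝ, (∀ t ∈ T, Measurable (h t)) → (∀ t ∈ T, ∀ z, |h t z| ≤ c) →
      Integrable (fun z => Real.exp (T.sup' hT fun t => u t + 2 * h t z)) P := by
    intro h hm hc
    refine integrable_exp_sup' hT (fun t ht => ((hm t ht).const_mul 2).const_add _)
      (c := U + 2 * c) fun t ht z => ?_
    linarith [huU t ht, (abs_le.1 (hc t ht z)).2]
  have im : ∀ h : ι → Z → ℝ, (∀ t ∈ T, Measurable (h t)) → (∀ t ∈ T, ∀ z, |h t z| ≤ c) →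
      Integrable (fun z => Real.exp (T.sup' hT fun t => u t - 2 * h t z)) P := by
    intro h hm hc
    refine integrable_exp_sup' hT (fun t ht => ((hm t ht).const_mul 2).const_sub _)
      (c := U + 2 * c) fun t ht z => ?_
    linarith [huU t ht, (abs_le.1 (hc t ht z)).1]
  set A := ∫ z', Real.exp (T.sup' hT fun t => u t + 2 * f t z') ∂P with hA
  have point : ∀ z, Real.exp (T.sup' hT fun t => u t + ((∫ z', f t z' ∂P) - f t z)) ≤
      (1 / 2) * (A + Real.exp (T.sup' hT fun t => u t - 2 * f t z)) := by
    intro z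
    refine exp_sup'_le hT fun t ht => ?_
    have jensen : Real.exp (∫ z', (u t + 2 * f t z') ∂P) ≤
        ∫ z', Real.exp (u t + 2 * f t z') ∂P := by
      refine (convexOn_exp).map_integral_le Real.continuous_exp.continuousOn isClosed_univ
        (by simp) ((integrable_const _).add ((hfi t ht).const_mul 2)) ?_
      refine Integrable.of_bound (Real.measurable_exp.comp
        (((hfm t ht).const_mul 2).const_add _)).aestronglyMeasurable (Real.exp (U + 2 * c))
        (Filter.Eventually.of_forall fun z => ?_)
      rw [Function.comp_apply, Real.norm_eq_abs, abs_of_pos (Real.exp_pos _)]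
      exact Real.exp_le_exp.2 (by linarith [huU t ht, (abs_le.1 (hfc t ht z)).2])
    have hA' : ∫ z', Real.exp (u t + 2 * f t z') ∂P ≤ A := by
      refine integral_mono_of_nonneg (Filter.Eventually.of_forall fun z => (Real.exp_pos _).le)
        (ip f hfm hfc) (Filter.Eventually.of_forall fun z => ?_)
      exact exp_le_exp_sup' hT (u := fun t => u t + 2 * f t z) ht
    have hint : ∫ z', (u t + 2 * f t z') ∂P = u t + 2 * ∫ z', f t z' ∂P := by
      rw [integral_add (integrable_const _) ((hfi t ht).const_mul 2), integral_const_mul]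
      simp
    have h2 := exp_le_exp_sup' hT (u := fun t => u t - 2 * f t z) ht
    have amgm : ∀ x y : ℝ, Real.exp ((x + y) / 2) ≤ (1 / 2) * (Real.exp x + Real.exp y) := by
      intro x y
      have hx : Real.exp x = Real.exp (x / 2) ^ 2 := by
        rw [sq, ← Real.exp_add]; ring_nf
      have hy : Real.exp y = Real.exp (y / 2) ^ 2 := by
        rw [sq, ← Real.exp_add]; ring_nf
      have hxy : Real.exp ((x + y) / 2) = Real.exp (x / 2) * Real.exp (y / 2) := by
        rw [← Real.exp_add]; ring_nf
      rw [hx, hy, hxy]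
      nlinarith [sq_nonneg (Real.exp (x / 2) - Real.exp (y / 2))]
    have h3 := amgm (u t + 2 * ∫ z', f t z' ∂P) (u t - 2 * f t z)
    rw [show (u t + 2 * ∫ z', f t z' ∂P + (u t - 2 * f t z)) / 2 =
      u t + ((∫ z', f t z' ∂P) - f t z) by ring] at h3
    rw [hint] at jensen
    linarith
  have contr : ∀ z, Real.exp (T.sup' hT fun t => u t + 2 * f t z) +
      Real.exp (T.sup' hT fun t => u t - 2 * f t z) ≤
      Real.exp (T.sup' hT fun t => u t + 2 * g t z) +
        Real.exp (T.sup' hT fun t => u t - 2 * g t z) := by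
    intro z
    refine exp_sup'_contraction hT u (fun t => 2 * f t z) (fun t => 2 * g t z)
      (fun t ht => ?_) fun s hs t ht => ?_
    · rw [abs_mul, abs_mul]
      exact mul_le_mul_of_nonneg_left (hf t ht z) (abs_nonneg _)
    · rw [← mul_sub, ← mul_sub, abs_mul, abs_mul]
      exact mul_le_mul_of_nonneg_left (hfg s hs t ht z) (abs_nonneg _)
  calc _ ≤ ∫ z, (1 / 2) * (A + Real.exp (T.sup' hT fun t => u t - 2 * f t z)) ∂P :=
        integral_mono_of_nonneg (Filter.Eventually.of_forall fun z => (Real.exp_pos _).le)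
          (((integrable_const _).add (im f hfm hfc)).const_mul _)
          (Filter.Eventually.of_forall point)
    _ = ∫ z, (1 / 2) * (Real.exp (T.sup' hT fun t => u t + 2 * f t z) +
          Real.exp (T.sup' hT fun t => u t - 2 * f t z)) ∂P := by
        rw [integral_const_mul, integral_const_mul,
          integral_add (integrable_const _) (im f hfm hfc),
          integral_add (ip f hfm hfc) (im f hfm hfc)]
        simp [hA]
    _ ≤ _ := by
        refine integral_mono (((ip f hfm hfc).add (im f hfm hfc)).const_mul _)
          (((ip g hgm hgc).add (im g hgm hgc)).const_mul _) fun z => ?_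
        exact mul_le_mul_of_nonneg_left (contr z) (by norm_num)

theorem pow_add_pow_le_of_add_eq_add {x y X Y : ℝ} (hY : 0 ≤ Y) (hx : x ≤ X) (hy : y ≤ X)
    (h : x + y = X + Y) (k : ℕ) : x ^ k + y ^ k ≤ X ^ k + Y ^ k := by
  have hYx : Y ≤ x := by linarith
  have hYy : Y ≤ y := by linarith
  suffices y ^ k - Y ^ k ≤ X ^ k - x ^ k by linarith
  induction k with
  | zero => simp
  | succ k ih =>
    have h1 : Y ^ k ≤ y ^ k := pow_le_pow_left₀ hY hYy k
    have h2 : Y ^ k ≤ x ^ k := pow_le_pow_left₀ hY hYx k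
    have h3 : y * (y ^ k - Y ^ k) ≤ X * (X ^ k - x ^ k) :=
      mul_le_mul hy ih (by linarith) (by linarith)
    have h4 : Y ^ k * (y - Y) ≤ x ^ k * (y - Y) :=
      mul_le_mul_of_nonneg_right h2 (by linarith)
    have h5 : y - Y = X - x := by linarith
    calc y ^ (k + 1) - Y ^ (k + 1) = y * (y ^ k - Y ^ k) + Y ^ k * (y - Y) := by ring
      _ ≤ X * (X ^ k - x ^ k) + x ^ k * (X - x) := by rw [← h5]; exact add_le_add h3 h4
      _ = _ := by ring

/-- Pinelis' inequality: the hyperbolic cosine of the norm is submultiplicative under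
symmetrization. Both sides are compared term by term in the power series of `cosh`, where
`‖a + v‖ ^ 2 + ‖a - v‖ ^ 2 = (‖a‖ + ‖v‖) ^ 2 + (‖a‖ - ‖v‖) ^ 2`. -/
theorem cosh_norm_add_add_cosh_norm_sub_le {E : Type*} [NormedAddCommGroup E]
    [InnerProductSpace ℝ E] (B : ℝ) (a v : E) :
    Real.cosh (B * ‖a + v‖) + Real.cosh (B * ‖a - v‖) ≤
      2 * (Real.cosh (B * ‖a‖) * Real.cosh (B * ‖v‖)) := by
  have hprod : 2 * (Real.cosh (B * ‖a‖) * Real.cosh (B * ‖v‖)) =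
      Real.cosh (B * (‖a‖ + ‖v‖)) + Real.cosh (B * (‖a‖ - ‖v‖)) := by
    rw [mul_add, mul_sub, Real.cosh_add, Real.cosh_sub]
    ring
  rw [hprod]
  refine hasSum_le (fun k => ?_)
    ((Real.hasSum_cosh (B * ‖a + v‖)).add (Real.hasSum_cosh (B * ‖a - v‖)))
    ((Real.hasSum_cosh (B * (‖a‖ + ‖v‖))).add (Real.hasSum_cosh (B * (‖a‖ - ‖v‖))))
  rw [← add_div, ← add_div]
  refine div_le_div_of_nonneg_right ?_ (by positivity)
  simp only [pow_mul]
  have par := parallelogram_law_with_norm ℝ a v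
  refine pow_add_pow_le_of_add_eq_add (sq_nonneg _) ?_ ?_ ?_ k
  · rw [mul_pow, mul_pow]
    exact mul_le_mul_of_nonneg_left
      (pow_le_pow_left₀ (norm_nonneg _) (norm_add_le a v) 2) (sq_nonneg B)
  · rw [mul_pow, mul_pow]
    exact mul_le_mul_of_nonneg_left
      (pow_le_pow_left₀ (norm_nonneg _) (norm_sub_le a v) 2) (sq_nonneg B)
  · linear_combination B ^ 2 * par

/-- Exponential moment of a uniform deviation. If `f` is dominated by the linear class
`t ↦ ⟪t, v z⟫`, in the sense of a contraction, then the supremum over `t ∈ T` of the centered sums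
of `f` has sub-Gaussian exponential moments whatever the size of `T`. The linear term `⟪t, a⟫` is
what makes an induction on the number of summands possible: symmetrizing one summand turns it into
`⟪t, a ± 2 v z⟫`. -/
theorem lintegral_exp_sup'_sum_centered_le {E : Type*} [NormedAddCommGroup E]
    [InnerProductSpace ℝ E] {T : Finset E} (hT : T.Nonempty) {Z : Type*} [MeasurableSpace Z]
    {P : Measure Z} [IsProbabilityMeasure P] {f : E → Z → ℝ} {v : Z → E} {B c : ℝ}
    (hc : 0 ≤ c)
    (hTB : ∀ t ∈ T, ‖t‖ ≤ B) (hvc : ∀ z, ‖v z‖ ≤ c)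
    (hfm : ∀ t ∈ T, Measurable (f t)) (hvm : ∀ t ∈ T, Measurable fun z => inner ℝ t (v z))
    (hf : ∀ t ∈ T, ∀ z, |f t z| ≤ |inner ℝ t (v z)|)
    (hfg : ∀ s ∈ T, ∀ t ∈ T, ∀ z, |f s z - f t z| ≤ |inner ℝ s (v z) - inner ℝ t (v z)|)
    (k : ℕ) (a : E) :
    ∫⁻ S : Fin k → Z, ENNReal.ofReal (Real.exp (T.sup' hT fun t =>
        inner ℝ t a + ∑ i, ((∫ z', f t z' ∂P) - f t (S i)))) ∂(Measure.pi fun _ => P) ≤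
      ENNReal.ofReal (2 * (Real.cosh (B * ‖a‖) * Real.cosh (B * (2 * c)) ^ k)) := by
  obtain ⟨t₀, ht₀⟩ := hT
  have hB : 0 ≤ B := (norm_nonneg _).trans (hTB t₀ ht₀)
  induction k generalizing a with
  | zero =>
    simp only [Finset.univ_eq_empty, Finset.sum_empty, add_zero, lintegral_const, measure_univ,
      mul_one, pow_zero]
    refine ENNReal.ofReal_le_ofReal ?_
    have h1 : T.sup' ⟨t₀, ht₀⟩ (fun t => inner ℝ t a) ≤ B * ‖a‖ :=
      Finset.sup'_le _ _ fun t ht => (real_inner_le_norm t a).trans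
        (mul_le_mul_of_nonneg_right (hTB t ht) (norm_nonneg _))
    have h2 := Real.exp_le_exp.2 h1
    have h3 := Real.exp_pos (-(B * ‖a‖))
    rw [Real.cosh_eq]
    linarith
  | succ k ih =>
    have hT : T.Nonempty := ⟨t₀, ht₀⟩
    set N : (Fin k → Z) → E → ℝ := fun S t =>
      ∑ i, ((∫ z', f t z' ∂P) - f t (S i)) with hN
    have hNm : ∀ t ∈ T, Measurable fun S => N S t := fun t ht =>
      Finset.measurable_sum _ fun i _ =>
        ((hfm t ht).comp (measurable_pi_apply i)).const_sub _
    -- the sum over `k + 1` variables, with the first one split off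
    have split : ∫⁻ S : Fin (k + 1) → Z, ENNReal.ofReal (Real.exp (T.sup' hT fun t =>
          inner ℝ t a + ∑ i, ((∫ z', f t z' ∂P) - f t (S i)))) ∂(Measure.pi fun _ => P) =
        ∫⁻ S : Fin k → Z, ∫⁻ z, ENNReal.ofReal (Real.exp (T.sup' hT fun t =>
          (inner ℝ t a + N S t) + ((∫ z', f t z' ∂P) - f t z))) ∂P
          ∂(Measure.pi fun _ => P) := by
      have mp := measurePreserving_piFinSuccAbove (fun _ : Fin (k + 1) => P) 0
      have hm : Measurable fun q : Z × (Fin k → Z) => ENNReal.ofReal (Real.exp (T.sup' hT fun t =>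
          (inner ℝ t a + N q.2 t) + ((∫ z', f t z' ∂P) - f t q.1))) := by
        refine ENNReal.measurable_ofReal.comp (Real.measurable_exp.comp
          (measurable_sup'_fun hT fun t ht => ?_))
        exact (((hNm t ht).comp measurable_snd).const_add _).add
          (((hfm t ht).comp measurable_fst).const_sub _)
      rw [← lintegral_prod_symm' _ hm, ← mp.lintegral_comp hm]
      refine lintegral_congr fun S => ?_
      congr 2
      refine Finset.sup'_congr hT rfl fun t _ => ?_
      rw [Fin.sum_univ_succ]
      simp [hN, MeasurableEquiv.piFinSuccAbove, Fin.insertNthEquiv, Fin.tail]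
      ring
    rw [split]
    have gint : ∀ z, ∀ t ∈ T, |inner ℝ t (v z)| ≤ B * c := fun z t ht =>
      (abs_real_inner_le_norm t (v z)).trans
        (mul_le_mul (hTB t ht) (hvc z) (norm_nonneg _) hB)
    have step : ∀ S : Fin k → Z, ∫⁻ z, ENNReal.ofReal (Real.exp (T.sup' hT fun t =>
          (inner ℝ t a + N S t) + ((∫ z', f t z' ∂P) - f t z))) ∂P ≤
        ∫⁻ z, ENNReal.ofReal (1 / 2) *
          (ENNReal.ofReal (Real.exp (T.sup' hT fun t =>
            inner ℝ t (a + (2 : ℝ) • v z) + N S t)) +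
          ENNReal.ofReal (Real.exp (T.sup' hT fun t =>
            inner ℝ t (a - (2 : ℝ) • v z) + N S t))) ∂P := by
      intro S
      set u : E → ℝ := fun t => inner ℝ t a + N S t with hu
      have hfc : ∀ t ∈ T, ∀ z, |f t z| ≤ B * c := fun t ht z => (hf t ht z).trans (gint z t ht)
      have huU : ∀ t ∈ T, u t ≤ T.sup' hT u := fun t ht => T.le_sup' u ht
      have i0 : Integrable (fun z => Real.exp (T.sup' hT fun t =>
          u t + ((∫ z', f t z' ∂P) - f t z))) P := by
        refine integrable_exp_sup' hT (c := T.sup' hT u + (T.sup' hT (fun t => ∫ z', f t z' ∂P)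
          + B * c)) (fun t ht => ((hfm t ht).const_sub _).const_add _) fun t ht z => ?_
        have := T.le_sup' (fun t => ∫ z', f t z' ∂P) ht
        linarith [huU t ht, (abs_le.1 (hfc t ht z)).1]
      have ip : Integrable (fun z => Real.exp (T.sup' hT fun t =>
          u t + 2 * inner ℝ t (v z))) P := by
        refine integrable_exp_sup' hT (c := T.sup' hT u + 2 * (B * c))
          (fun t ht => ((hvm t ht).const_mul 2).const_add _) fun t ht z => ?_
        linarith [huU t ht, (abs_le.1 (gint z t ht)).2]
      have im : Integrable (fun z => Real.exp (T.sup' hT fun t =>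
          u t - 2 * inner ℝ t (v z))) P := by
        refine integrable_exp_sup' hT (c := T.sup' hT u + 2 * (B * c))
          (fun t ht => ((hvm t ht).const_mul 2).const_sub _) fun t ht z => ?_
        linarith [huU t ht, (abs_le.1 (gint z t ht)).1]
      have main := integral_exp_sup'_centered_le hT (P := P) u hfm hvm
        (fun t ht z => gint z t ht) hf hfg
      rw [← ofReal_integral_eq_lintegral_ofReal i0
        (Filter.Eventually.of_forall fun z => (Real.exp_pos _).le)]
      refine (ENNReal.ofReal_le_ofReal main).trans (le_of_eq ?_)
      refine (ofReal_integral_eq_lintegral_ofReal ((ip.add im).const_mul (1 / 2))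
        (Filter.Eventually.of_forall fun z => mul_nonneg (by norm_num)
          (add_nonneg (Real.exp_pos _).le (Real.exp_pos _).le))).trans
        (lintegral_congr fun z => ?_)
      simp only [Pi.add_apply]
      rw [ENNReal.ofReal_mul (by norm_num), ENNReal.ofReal_add (by positivity) (by positivity)]
      congr 5 <;>
      · funext t
        simp only [hu, inner_add_right, inner_sub_right, inner_smul_right]
        ring
    have mz : ∀ σ : ℝ, Measurable fun q : (Fin k → Z) × Z =>
        ENNReal.ofReal (Real.exp (T.sup' hT fun t =>
          inner ℝ t a + σ * inner ℝ t (v q.2) + N q.1 t)) := fun σ =>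
      ENNReal.measurable_ofReal.comp (Real.measurable_exp.comp
        (measurable_sup'_fun hT fun t ht =>
          (((((hvm t ht).comp measurable_snd).const_mul σ).const_add _).add
            ((hNm t ht).comp measurable_fst))))
    have mp : Measurable fun q : (Fin k → Z) × Z =>
        ENNReal.ofReal (Real.exp (T.sup' hT fun t =>
          inner ℝ t (a + (2 : ℝ) • v q.2) + N q.1 t)) := by
      convert mz 2 using 6
      simp [inner_add_right, inner_smul_right]
    have mm : Measurable fun q : (Fin k → Z) × Z =>
        ENNReal.ofReal (Real.exp (T.sup' hT fun t =>
          inner ℝ t (a - (2 : ℝ) • v q.2) + N q.1 t)) := by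
      convert mz (-2) using 6
      simp [inner_sub_right, inner_smul_right]
      ring
    refine (lintegral_mono step).trans ?_
    rw [lintegral_lintegral_swap ((mp.add mm).const_mul _).aemeasurable]
    have inner_bound : ∀ z, ∫⁻ S : Fin k → Z, ENNReal.ofReal (1 / 2) *
          (ENNReal.ofReal (Real.exp (T.sup' hT fun t =>
            inner ℝ t (a + (2 : ℝ) • v z) + N S t)) +
          ENNReal.ofReal (Real.exp (T.sup' hT fun t =>
            inner ℝ t (a - (2 : ℝ) • v z) + N S t))) ∂(Measure.pi fun _ => P) ≤
        ENNReal.ofReal (2 * (Real.cosh (B * ‖a‖) * Real.cosh (B * (2 * c)) ^ (k + 1))) := by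
      intro z
      have mp' : Measurable fun S : Fin k → Z => ENNReal.ofReal (Real.exp (T.sup' hT fun t =>
          inner ℝ t (a + (2 : ℝ) • v z) + N S t)) :=
        ENNReal.measurable_ofReal.comp (Real.measurable_exp.comp
          (measurable_sup'_fun hT fun t ht => (hNm t ht).const_add _))
      rw [lintegral_const_mul' _ _ ENNReal.ofReal_ne_top, lintegral_add_left mp']
      refine (mul_le_mul_right (add_le_add (ih (a + (2 : ℝ) • v z)) (ih (a - (2 : ℝ) • v z)))
        _).trans ?_
      have hpos : ∀ x, 0 ≤ Real.cosh x := fun x => (Real.cosh_pos x).le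
      rw [← ENNReal.ofReal_add
        (mul_nonneg (by norm_num) (mul_nonneg (hpos _) (pow_nonneg (hpos _) _)))
        (mul_nonneg (by norm_num) (mul_nonneg (hpos _) (pow_nonneg (hpos _) _))),
        ← ENNReal.ofReal_mul (by norm_num)]
      refine ENNReal.ofReal_le_ofReal ?_
      have h1 := cosh_norm_add_add_cosh_norm_sub_le B a ((2 : ℝ) • v z)
      have h2 : Real.cosh (B * ‖(2 : ℝ) • v z‖) ≤ Real.cosh (B * (2 * c)) := by
        rw [Real.cosh_le_cosh, abs_of_nonneg (by positivity), abs_of_nonneg (by positivity),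
          norm_smul, Real.norm_eq_abs, abs_two]
        exact mul_le_mul_of_nonneg_left (by linarith [hvc z]) hB
      have h3 : 0 ≤ Real.cosh (B * (2 * c)) ^ k := pow_nonneg (hpos _) _
      have h4 := mul_le_mul_of_nonneg_left h2 (hpos (B * ‖a‖))
      have h5 := mul_le_mul_of_nonneg_right 
        (h1.trans (mul_le_mul_of_nonneg_left h4 zero_le_two)) h3
      rw [pow_succ]
      linarith
    refine (lintegral_mono inner_bound).trans ?_
    simp

end ExponentialMoment

/-! ### Averages over pairs of sample points -/

section PairSampling

theorem sum_perm_apply_pair_eq {α : Type*} [Fintype α] [DecidableEq α] (h : α → α → ℝ)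
    {a b a' b' : α} (hab : a ≠ b) (hab' : a' ≠ b') :
    ∑ π : Equiv.Perm α, h (π a) (π b) = ∑ π : Equiv.Perm α, h (π a') (π b') := by
  obtain ⟨τ, h₁, h₂⟩ : ∃ τ : Equiv.Perm α, τ a' = a ∧ τ b' = b := by
    have hne : a ≠ Equiv.swap a' a b' := by
      intro h
      apply hab'
      apply (Equiv.swap a' a).injective
      rw [← h, Equiv.swap_apply_left]
    refine ⟨Equiv.swap (Equiv.swap a' a b') b * Equiv.swap a' a, ?_, ?_⟩
    · rw [Equiv.Perm.mul_apply, Equiv.swap_apply_left, Equiv.swap_apply_of_ne_of_ne hne hab]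
    · rw [Equiv.Perm.mul_apply, Equiv.swap_apply_left]
  rw [← Equiv.sum_comp (Equiv.mulRight τ) (fun π : Equiv.Perm α => h (π a') (π b'))]
  simp [h₁, h₂]

theorem offDiag_card_mul_sum_perm {α : Type*} [Fintype α] [DecidableEq α] (h : α → α → ℝ)
    {a b : α} (hab : a ≠ b) :
    ((Finset.univ : Finset α).offDiag.card : ℝ) * ∑ π : Equiv.Perm α, h (π a) (π b) =
      (Fintype.card (Equiv.Perm α) : ℝ) *
        ∑ q ∈ (Finset.univ : Finset α).offDiag, h q.1 q.2 := by
  calc _ = ∑ q ∈ (Finset.univ : Finset α).offDiag, ∑ π : Equiv.Perm α, h (π q.1) (π q.2) := by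
        rw [← nsmul_eq_mul, ← Finset.sum_const]
        refine Finset.sum_congr rfl fun q hq => ?_
        exact sum_perm_apply_pair_eq h hab (Finset.mem_offDiag.1 hq).2.2
    _ = ∑ π : Equiv.Perm α, ∑ q ∈ (Finset.univ : Finset α).offDiag, h q.1 q.2 := by
        rw [Finset.sum_comm]
        refine Finset.sum_congr rfl fun π _ => ?_
        refine Finset.sum_equiv (π.prodCongr π) (fun q => ?_) fun q _ => rfl
        simp
    _ = _ := by simp

theorem sum_lt_eq_half_sum_offDiag {n : ℕ} (h : Fin n → Fin n → ℝ) (hs : ∀ i j, h i j = h j i) :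
    ∑ i : Fin n, ∑ j : Fin n with i < j, h i j =
      (1 / 2) * ∑ q ∈ (Finset.univ : Finset (Fin n)).offDiag, h q.1 q.2 := by
  have e1 : ∑ q ∈ (Finset.univ : Finset (Fin n)).offDiag, h q.1 q.2 =
      ∑ i : Fin n, ∑ j : Fin n, if i ≠ j then h i j else 0 := by
    rw [← Fintype.sum_prod_type' (f := fun i j => if i ≠ j then h i j else 0),
      ← Finset.sum_filter]
    refine Finset.sum_congr ?_ fun _ _ => rfl
    ext q
    simp
  have e2 : ∀ i j : Fin n, (if i ≠ j then h i j else 0) =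
      (if i < j then h i j else 0) + if j < i then h j i else 0 := by
    intro i j
    rcases lt_trichotomy i j with hij | hij | hij
    · simp [hij, hij.ne, hij.not_gt]
    · simp [hij]
    · simp [hij, hij.ne', hij.not_gt, hs i j]
  simp_rw [e1, e2, Finset.sum_add_distrib, Finset.sum_filter]
  rw [Finset.sum_comm (f := fun i j => if j < i then h j i else 0)]
  ring

/-- Hoeffding's representation of a U-statistic: the mean over all pairs is the mean, over all
permutations of the sample, of the mean over a fixed family of pairs. -/
theorem pair_mean_eq_perm_mean {n m : ℕ} (hm : 0 < m) (h : Fin n → Fin n → ℝ)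
    (hs : ∀ i j, h i j = h j i) {a b : Fin m → Fin n} (hab : ∀ i, a i ≠ b i) :
    2 / ((n : ℝ) * ((n : ℝ) - 1)) * ∑ i : Fin n, ∑ j : Fin n with i < j, h i j =
      ∑ π : Equiv.Perm (Fin n), (Fintype.card (Equiv.Perm (Fin n)) : ℝ)⁻¹ *
        ∑ i : Fin m, (m : ℝ)⁻¹ * h (π (a i)) (π (b i)) := by
  have hn : 2 ≤ n := by
    have h1 := (a ⟨0, hm⟩).2
    have h2 := (b ⟨0, hm⟩).2
    have h3 := Fin.val_ne_of_ne (hab ⟨0, hm⟩)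
    omega
  have hn' : (2 : ℝ) ≤ n := by exact_mod_cast hn
  have hcard : ((Finset.univ : Finset (Fin n)).offDiag.card : ℝ) = n * (n - 1) := by
    rw [Finset.offDiag_card, Finset.card_univ, Fintype.card_fin, Nat.cast_sub (by nlinarith)]
    push_cast
    ring
  have hN : (0 : ℝ) < n * (n - 1) := mul_pos (by linarith) (by linarith)
  have hF : (0 : ℝ) < Fintype.card (Equiv.Perm (Fin n)) := by exact_mod_cast Fintype.card_pos
  have hm' : (0 : ℝ) < m := by exact_mod_cast hm
  have key : ∀ i : Fin m, ∑ π : Equiv.Perm (Fin n), h (π (a i)) (π (b i)) =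
      (Fintype.card (Equiv.Perm (Fin n)) : ℝ) / (n * (n - 1)) *
        ∑ q ∈ (Finset.univ : Finset (Fin n)).offDiag, h q.1 q.2 := by
    intro i
    have := offDiag_card_mul_sum_perm h (hab i)
    rw [hcard] at this
    rw [div_mul_eq_mul_div, eq_div_iff hN.ne', ← this]
    ring
  rw [sum_lt_eq_half_sum_offDiag h hs, ← Finset.mul_sum, Finset.sum_comm]
  simp_rw [← Finset.mul_sum, key]
  rw [Finset.sum_const, Finset.card_univ, Fintype.card_fin, nsmul_eq_mul]
  field_simp

/-- Disjoint pairs of coordinates of an independent sample are an independent sample of pairs. -/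
theorem measurePreserving_pairs {Z : Type*} [MeasurableSpace Z] (D : Measure Z)
    [IsProbabilityMeasure D] {n m : ℕ} {a b : Fin m → Fin n}
    (hab : Function.Injective (Sum.elim a b)) :
    MeasurePreserving (fun (S : Fin n → Z) (i : Fin m) => (S (a i), S (b i)))
      (Measure.pi fun _ => D) (Measure.pi fun _ => D.prod D) := by
  have h1 : MeasurePreserving (fun (S : Fin n → Z) (k : Fin m ⊕ Fin m) => S (Sum.elim a b k))
      (Measure.pi fun _ => D) (Measure.pi fun _ => D) := by
    refine ⟨by fun_prop, ?_⟩
    have hind : ProbabilityTheory.iIndepFun (fun (i : Fin n) (S : Fin n → Z) => S i)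
        (Measure.pi fun _ => D) :=
      ProbabilityTheory.iIndepFun_pi (X := fun _ => id) fun _ => aemeasurable_id
    have := (ProbabilityTheory.iIndepFun_iff_map_fun_eq_pi_map
      (fun k => (measurable_pi_apply (Sum.elim a b k)).aemeasurable)).1 (hind.precomp hab)
    refine this.trans ?_
    congr 1
    funext k
    exact (measurePreserving_eval (fun _ : Fin n => D) (Sum.elim a b k)).map_eq
  have h2 := measurePreserving_sumPiEquivProdPi (X := fun _ : Fin m ⊕ Fin m => Z) fun _ => D
  have h3 := (measurePreserving_arrowProdEquivProdArrow Z Z (Fin m) (fun _ => D)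
    (fun _ => D)).symm
  exact h3.comp (h2.comp h1)

end PairSampling

/-! ### Uniform deviation of U-statistics of order two -/

section UniformDeviation

/-- The average of `f` over all arrangements of the sample `S` into the pairs `(a i, b i)`. -/
noncomputable def permMean {Z : Type*} {n m : ℕ} (a b : Fin m → Fin n) (f : Z × Z → ℝ)
    (S : Fin n → Z) : ℝ :=
  ∑ π : Equiv.Perm (Fin n), (Fintype.card (Equiv.Perm (Fin n)) : ℝ)⁻¹ *
    ∑ i : Fin m, (m : ℝ)⁻¹ * f (S (π (a i)), S (π (b i)))

theorem measurable_permMean {Z : Type*} [MeasurableSpace Z] {n m : ℕ} (a b : Fin m → Fin n)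
    {f : Z × Z → ℝ} (hf : Measurable f) :
    Measurable (permMean a b f) := by
  unfold permMean
  refine Finset.measurable_sum _ fun π _ => (Finset.measurable_sum _ fun i _ => ?_).const_mul _
  exact (hf.comp ((measurable_pi_apply _).prodMk (measurable_pi_apply _))).const_mul _

theorem sum_perm_inv_card (n : ℕ) :
    ∑ _π : Equiv.Perm (Fin n), (Fintype.card (Equiv.Perm (Fin n)) : ℝ)⁻¹ = 1 := by
  rw [Finset.sum_const, Finset.card_univ, nsmul_eq_mul]
  exact mul_inv_cancel₀ (by exact_mod_cast Fintype.card_ne_zero)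

theorem sum_fin_inv {m : ℕ} (hm : 0 < m) : ∑ _i : Fin m, (m : ℝ)⁻¹ = 1 := by
  rw [Finset.sum_const, Finset.card_univ, nsmul_eq_mul, Fintype.card_fin]
  exact mul_inv_cancel₀ (by exact_mod_cast hm.ne')

theorem permMean_const {Z : Type*} {n m : ℕ} (hm : 0 < m) (a b : Fin m → Fin n) (r : ℝ)
    (S : Fin n → Z) :
    permMean a b (fun _ => r) S = r := by
  unfold permMean
  rw [← Finset.sum_mul, sum_perm_inv_card, one_mul, ← Finset.sum_mul, sum_fin_inv hm, one_mul]

theorem permMean_sub {Z : Type*} {n m : ℕ} (a b : Fin m → Fin n) (f g : Z × Z → ℝ)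
    (S : Fin n → Z) :
    permMean a b (fun z => f z - g z) S = permMean a b f S - permMean a b g S := by
  unfold permMean
  rw [← Finset.sum_sub_distrib]
  refine Finset.sum_congr rfl fun π _ => ?_
  rw [← mul_sub, ← Finset.sum_sub_distrib]
  simp_rw [mul_sub]

theorem permMean_mono {Z : Type*} {n m : ℕ} (a b : Fin m → Fin n) {f g : Z × Z → ℝ}
    (h : ∀ z, f z ≤ g z)
    (S : Fin n → Z) : permMean a b f S ≤ permMean a b g S := by
  unfold permMean
  gcongr
  exact h _

variable {E : Type*} [NormedAddCommGroup E] [InnerProductSpace ℝ E]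
  {Z : Type*} [MeasurableSpace Z] {D : Measure Z} [IsProbabilityMeasure D]
  {f : E → Z × Z → ℝ} {v : Z × Z → E} {B c : ℝ}

/-- The exponential moment of the uniform deviation of a U-statistic of order two. By convexity it
is at most the one of the mean over `m` disjoint, hence independent, pairs. -/
theorem lintegral_exp_sup'_permMean_le {T : Finset E} (hT : T.Nonempty) (hc : 0 ≤ c)
    (hTB : ∀ t ∈ T, ‖t‖ ≤ B) (hvc : ∀ z, ‖v z‖ ≤ c)
    (hfm : ∀ t ∈ T, Measurable (f t)) (hvm : ∀ t ∈ T, Measurable fun z => inner ℝ t (v z))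
    (hf : ∀ t ∈ T, ∀ z, |f t z| ≤ |inner ℝ t (v z)|)
    (hfg : ∀ s ∈ T, ∀ t ∈ T, ∀ z, |f s z - f t z| ≤ |inner ℝ s (v z) - inner ℝ t (v z)|)
    {n m : ℕ} (hm : 0 < m) {a b : Fin m → Fin n} (hab : Function.Injective (Sum.elim a b))
    {θ : ℝ} (hθ : 0 ≤ θ) :
    ∫⁻ S : Fin n → Z, ENNReal.ofReal (Real.exp (T.sup' hT fun t =>
        θ * ((∫ z, f t z ∂(D.prod D)) - permMean a b (f t) S))) ∂(Measure.pi fun _ => D) ≤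
      ENNReal.ofReal (2 * Real.exp (2 * θ ^ 2 * (B * c) ^ 2 / m)) := by
  have hm' : (0 : ℝ) < m := by exact_mod_cast hm
  set w : ℝ := (Fintype.card (Equiv.Perm (Fin n)) : ℝ)⁻¹ with hw
  have hw0 : 0 ≤ w := by positivity
  set s : ℝ := θ / m with hs
  have hs0 : 0 ≤ s := by positivity
  -- the exponential of the deviation for one arrangement into pairs
  set F : (Fin m → Z × Z) → ℝ := fun Q => Real.exp (T.sup' hT fun t =>
    inner ℝ t (0 : E) + ∑ i, ((∫ z, s * f t z ∂(D.prod D)) - s * f t (Q i))) with hF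
  have hFm : Measurable F := by
    refine Real.measurable_exp.comp (measurable_sup'_fun hT fun t ht => ?_)
    refine (Finset.measurable_sum _ fun i _ => ?_).const_add _
    exact (((hfm t ht).comp (measurable_pi_apply i)).const_mul s).const_sub _
  have bound : ∫⁻ Q, ENNReal.ofReal (F Q) ∂(Measure.pi fun _ : Fin m => D.prod D) ≤
      ENNReal.ofReal (2 * Real.exp (2 * θ ^ 2 * (B * c) ^ 2 / m)) := by
    refine (lintegral_exp_sup'_sum_centered_le hT (P := D.prod D) (f := fun t z => s * f t z)
      (v := fun z => s • v z) (B := B) (c := s * c) (mul_nonneg hs0 hc) hTB (fun z => ?_)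
      (fun t ht => (hfm t ht).const_mul s) (fun t ht => ?_) (fun t ht z => ?_)
      (fun t ht t' ht' z => ?_) m 0).trans (ENNReal.ofReal_le_ofReal ?_)
    · rw [norm_smul, Real.norm_eq_abs, abs_of_nonneg hs0]
      exact mul_le_mul_of_nonneg_left (hvc z) hs0
    · simp_rw [inner_smul_right]
      exact (hvm t ht).const_mul s
    · rw [inner_smul_right, abs_mul, abs_mul]
      exact mul_le_mul_of_nonneg_left (hf t ht z) (abs_nonneg s)
    · rw [inner_smul_right, inner_smul_right, ← mul_sub, ← mul_sub, abs_mul, abs_mul]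
      exact mul_le_mul_of_nonneg_left (hfg t ht t' ht' z) (abs_nonneg s)
    · rw [norm_zero, mul_zero, Real.cosh_zero, one_mul]
      refine mul_le_mul_of_nonneg_left ?_ zero_le_two
      refine (pow_le_pow_left₀ (Real.cosh_pos _).le (Real.cosh_le_exp_half_sq _) m).trans ?_
      rw [← Real.exp_nat_mul]
      refine le_of_eq (congrArg Real.exp ?_)
      rw [hs]
      field_simp
  have jensen : ∀ S : Fin n → Z, Real.exp (T.sup' hT fun t =>
      θ * ((∫ z, f t z ∂(D.prod D)) - permMean a b (f t) S)) ≤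
      ∑ π : Equiv.Perm (Fin n), w * F fun i => (S (π (a i)), S (π (b i))) := by
    intro S
    refine exp_sup'_le hT fun t ht => ?_
    have e : θ * ((∫ z, f t z ∂(D.prod D)) - permMean a b (f t) S) =
        ∑ π : Equiv.Perm (Fin n), w • (inner ℝ t (0 : E) +
          ∑ i, ((∫ z, s * f t z ∂(D.prod D)) - s * f t (S (π (a i)), S (π (b i))))) := by
      simp only [inner_zero_right, zero_add, Finset.sum_sub_distrib, smul_eq_mul, mul_sub,
        integral_const_mul]
      congr 1
      · rw [← Finset.sum_mul, hw, sum_perm_inv_card, one_mul, Finset.sum_const, Finset.card_univ,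
          Fintype.card_fin, nsmul_eq_mul, hs]
        field_simp
      · rw [permMean, Finset.mul_sum]
        refine Finset.sum_congr rfl fun π _ => ?_
        rw [mul_left_comm, ← Finset.mul_sum, ← Finset.mul_sum, hs]
        ring
    rw [e]
    refine (convexOn_exp.map_sum_le (fun π _ => hw0) (sum_perm_inv_card n)
      (fun π _ => Set.mem_univ _)).trans ?_
    refine Finset.sum_le_sum fun π _ => mul_le_mul_of_nonneg_left ?_ hw0
    exact exp_le_exp_sup' hT (u := fun t => inner ℝ t (0 : E) +
      ∑ i, ((∫ z, s * f t z ∂(D.prod D)) - s * f t (S (π (a i)), S (π (b i))))) ht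
  have mp : ∀ π : Equiv.Perm (Fin n), MeasurePreserving
      (fun (S : Fin n → Z) (i : Fin m) => (S (π (a i)), S (π (b i))))
      (Measure.pi fun _ => D) (Measure.pi fun _ => D.prod D) := by
    intro π
    refine measurePreserving_pairs D (a := π ∘ a) (b := π ∘ b) ?_
    rw [← Sum.comp_elim]
    exact π.injective.comp hab
  calc _ ≤ ∫⁻ S : Fin n → Z, ∑ π : Equiv.Perm (Fin n), ENNReal.ofReal w *
        ENNReal.ofReal (F fun i => (S (π (a i)), S (π (b i)))) ∂(Measure.pi fun _ => D) := by
        refine lintegral_mono fun S => (ENNReal.ofReal_le_ofReal (jensen S)).trans (le_of_eq ?_)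
        rw [ENNReal.ofReal_sum_of_nonneg fun π _ => mul_nonneg hw0 (Real.exp_pos _).le]
        exact Finset.sum_congr rfl fun π _ => ENNReal.ofReal_mul hw0
    _ = ∑ π : Equiv.Perm (Fin n), ENNReal.ofReal w *
          ∫⁻ Q, ENNReal.ofReal (F Q) ∂(Measure.pi fun _ : Fin m => D.prod D) := by
        rw [lintegral_finsetSum]
        · refine Finset.sum_congr rfl fun π _ => ?_
          rw [lintegral_const_mul' _ _ ENNReal.ofReal_ne_top]
          exact congrArg _ ((mp π).lintegral_comp (ENNReal.measurable_ofReal.comp hFm))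
        · intro π _
          exact (ENNReal.measurable_ofReal.comp (hFm.comp (mp π).measurable)).const_mul _
    _ = ∫⁻ Q, ENNReal.ofReal (F Q) ∂(Measure.pi fun _ : Fin m => D.prod D) := by
        rw [← Finset.sum_mul, ← ENNReal.ofReal_sum_of_nonneg fun _ _ => hw0, hw,
          sum_perm_inv_card, ENNReal.ofReal_one, one_mul]
    _ ≤ _ := bound

/-- Chernoff's bound for the uniform deviation over a finite set of parameters. -/
theorem measure_exists_mem_permMean_lt_le {T : Finset E} (hB : 0 < B) (hc : 0 < c)
    (hTB : ∀ t ∈ T, ‖t‖ ≤ B) (hvc : ∀ z, ‖v z‖ ≤ c)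
    (hfm : ∀ t, Measurable (f t)) (hvm : ∀ t, Measurable fun z => inner ℝ t (v z))
    (hf : ∀ t z, |f t z| ≤ |inner ℝ t (v z)|)
    (hfg : ∀ s t z, |f s z - f t z| ≤ |inner ℝ s (v z) - inner ℝ t (v z)|)
    {n m : ℕ} (hm : 0 < m) {a b : Fin m → Fin n} (hab : Function.Injective (Sum.elim a b))
    {r : ℝ} (hr : 0 ≤ r) :
    (Measure.pi fun _ => D) {S : Fin n → Z | ∃ t ∈ T,
        r < (∫ z, f t z ∂(D.prod D)) - permMean a b (f t) S} ≤
      ENNReal.ofReal (2 * Real.exp (-(m * r ^ 2 / (8 * (B * c) ^ 2)))) := by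
  rcases T.eq_empty_or_nonempty with rfl | hT
  · simp
  have hm' : (0 : ℝ) < m := by exact_mod_cast hm
  -- the exponent that minimizes Chernoff's bound
  set θ : ℝ := r * m / (4 * (B * c) ^ 2) with hθ
  have hθ0 : 0 ≤ θ := by positivity
  set W : (Fin n → Z) → ℝ := fun S => Real.exp (T.sup' hT fun t =>
    θ * ((∫ z, f t z ∂(D.prod D)) - permMean a b (f t) S)) with hW
  have hWm : Measurable W := Real.measurable_exp.comp (measurable_sup'_fun hT fun t _ =>
    ((measurable_permMean a b (hfm t)).const_sub _).const_mul _)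
  have hsub : {S : Fin n → Z | ∃ t ∈ T, r < (∫ z, f t z ∂(D.prod D)) - permMean a b (f t) S} ⊆
      {S | ENNReal.ofReal (Real.exp (θ * r)) ≤ ENNReal.ofReal (W S)} := by
    rintro S ⟨t, ht, hlt⟩
    refine ENNReal.ofReal_le_ofReal (le_trans ?_ (exp_le_exp_sup' hT (u := fun t =>
      θ * ((∫ z, f t z ∂(D.prod D)) - permMean a b (f t) S)) ht))
    exact Real.exp_le_exp.2 (mul_le_mul_of_nonneg_left hlt.le hθ0)
  refine (measure_mono hsub).trans ((meas_ge_le_lintegral_div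
    (ENNReal.measurable_ofReal.comp hWm).aemeasurable
    (ENNReal.ofReal_pos.2 (Real.exp_pos _)).ne' ENNReal.ofReal_ne_top).trans ?_)
  refine (ENNReal.div_le_div_right (lintegral_exp_sup'_permMean_le hT hc.le hTB hvc
    (fun t _ => hfm t) (fun t _ => hvm t) (fun t _ => hf t) (fun s _ t _ => hfg s t) hm hab hθ0)
    _).trans (le_of_eq ?_)
  rw [← ENNReal.ofReal_div_of_pos (Real.exp_pos _), mul_div_assoc, ← Real.exp_sub]
  congr 3
  rw [hθ]
  field_simp
  ring

/-- The uniform deviation over a ball. The ball is replaced by a countable dense subset, which is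
exhausted by finite sets. -/
theorem exists_measurableSet_permMean_deviation [TopologicalSpace.SeparableSpace E]
    (D : Measure Z) [IsProbabilityMeasure D] (hB : 0 < B)
    (hc : 0 < c) (hvc : ∀ z, ‖v z‖ ≤ c)
    (hfm : ∀ t, Measurable (f t)) (hvm : ∀ t, Measurable fun z => inner ℝ t (v z))
    (hf : ∀ t z, |f t z| ≤ |inner ℝ t (v z)|)
    (hfg : ∀ s t z, |f s z - f t z| ≤ |inner ℝ s (v z) - inner ℝ t (v z)|)
    {n m : ℕ} (hm : 0 < m) {a b : Fin m → Fin n} (hab : Function.Injective (Sum.elim a b))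
    {r : ℝ} (hr : 0 ≤ r) :
    ∃ N : Set (Fin n → Z), MeasurableSet N ∧
      (Measure.pi fun _ => D) N ≤
        ENNReal.ofReal (2 * Real.exp (-(m * r ^ 2 / (8 * (B * c) ^ 2)))) ∧
      ∀ S ∉ N, ∀ t, ‖t‖ ≤ B → (∫ z, f t z ∂(D.prod D)) - permMean a b (f t) S ≤ r := by
  classical
  set dev : E → (Fin n → Z) → ℝ := fun t S =>
    (∫ z, f t z ∂(D.prod D)) - permMean a b (f t) S with hdev
  have hdm : ∀ t, Measurable (dev t) := fun t => (measurable_permMean a b (hfm t)).const_sub _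
  have : Nonempty (Metric.closedBall (0 : E) B) := ⟨⟨0, by simp [hB.le]⟩⟩
  set d : ℕ → Metric.closedBall (0 : E) B := TopologicalSpace.denseSeq _ with hd
  set A : ℕ → Set (Fin n → Z) := fun k =>
    {S | ∃ t ∈ (Finset.range k).image (fun j => (d j : E)), r < dev t S} with hA
  have hAmono : Monotone A := by
    rintro k l hkl S ⟨t, ht, hlt⟩
    exact ⟨t, Finset.image_subset_image (Finset.range_mono hkl) ht, hlt⟩
  refine ⟨⋃ k, A k, MeasurableSet.iUnion fun k => ?_, ?_, fun S hS t ht => ?_⟩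
  · have : A k = ⋃ t ∈ (Finset.range k).image (fun j => (d j : E)), {S | r < dev t S} := by
      ext S
      simp [hA]
    rw [this]
    exact Finset.measurableSet_biUnion _ fun t _ => measurableSet_lt measurable_const (hdm t)
  · rw [hAmono.measure_iUnion]
    refine iSup_le fun k => measure_exists_mem_permMean_lt_le hB hc (fun t ht => ?_) hvc hfm hvm
      hf hfg hm hab hr
    obtain ⟨j, -, rfl⟩ := Finset.mem_image.1 ht
    exact mem_closedBall_zero_iff.1 (d j).2
  · have hlip : ∀ s t z, |f s z - f t z| ≤ c * ‖s - t‖ := by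
      intro s t z
      refine (hfg s t z).trans ?_
      rw [← inner_sub_left, mul_comm]
      exact (abs_real_inner_le_norm _ _).trans
        (mul_le_mul_of_nonneg_left (hvc z) (norm_nonneg _))
    have hint : ∀ t, Integrable (f t) (D.prod D) := fun t =>
      Integrable.of_bound (hfm t).aestronglyMeasurable (‖t‖ * c)
        (Filter.Eventually.of_forall fun z => (hf t z).trans ((abs_real_inner_le_norm _ _).trans
          (mul_le_mul_of_nonneg_left (hvc z) (norm_nonneg _))))
    have hlipdev : ∀ s t, dev s S - dev t S ≤ 2 * c * ‖s - t‖ := by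
      intro s t
      have h1 : (∫ z, f s z ∂(D.prod D)) - ∫ z, f t z ∂(D.prod D) ≤ c * ‖s - t‖ := by
        rw [← integral_sub (hint s) (hint t)]
        refine (integral_mono ((hint s).sub (hint t)) (integrable_const _) fun z =>
          (abs_le.1 (hlip s t z)).2).trans (le_of_eq ?_)
        simp
      have h2 : permMean a b (f t) S - permMean a b (f s) S ≤ c * ‖s - t‖ := by
        rw [← permMean_sub]
        refine (permMean_mono a b (fun z => ?_) S).trans
          (le_of_eq (permMean_const hm a b (c * ‖s - t‖) S))
        rw [norm_sub_rev]
        exact (abs_le.1 (hlip t s z)).2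
      simp only [hdev]
      linarith
    have hcont : Continuous fun t : Metric.closedBall (0 : E) B => dev t S := by
      have : LipschitzWith (Real.toNNReal (2 * c)) fun t => dev t S := by
        refine LipschitzWith.of_dist_le_mul fun s t => ?_
        rw [Real.coe_toNNReal _ (by positivity), Real.dist_eq, dist_eq_norm]
        refine abs_le.2 ⟨?_, hlipdev s t⟩
        have := hlipdev t s
        rw [norm_sub_rev] at this
        linarith
      exact this.continuous.comp continuous_subtype_val
    have hclosed : IsClosed {t : Metric.closedBall (0 : E) B | dev t S ≤ r} :=
      isClosed_le hcont continuous_const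
    have hrange : Set.range d ⊆ {t : Metric.closedBall (0 : E) B | dev t S ≤ r} := by
      rintro _ ⟨j, rfl⟩
      by_contra hj
      refine hS (Set.mem_iUnion.2 ⟨j + 1, (d j : E), ?_, not_le.1 hj⟩)
      exact Finset.mem_image_of_mem _ (Finset.self_mem_range_succ j)
    have huniv := (TopologicalSpace.denseRange_denseSeq (Metric.closedBall (0 : E) B)).closure_eq
    have := (closure_minimal hrange hclosed) (huniv ▸ Set.mem_univ (⟨t, by simpa using ht⟩ :
      Metric.closedBall (0 : E) B))
    exact this

end UniformDeviation

/-! ### Good kernels and the pairwise hinge risk -/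

section KernelGoodness

/-- The pairing with a fixed vector is measurable as soon as the kernel is: a vector orthogonal to
the image of `Φ` pairs to zero, and one of its closed span is a limit of linear combinations of
values of `Φ`. -/
theorem measurable_inner_of_measurable_kernel {X H : Type*} [MeasurableSpace X]
    [NormedAddCommGroup H] [InnerProductSpace ℝ H] [CompleteSpace H] {Φ : X → H}
    (hΦ : ∀ x', Measurable fun x => inner ℝ (Φ x') (Φ x)) (h : H) :
    Measurable fun x => inner ℝ h (Φ x) := by
  set M : Submodule ℝ H := (Submodule.span ℝ (Set.range Φ)).topologicalClosure with hM
  have hMc : IsClosed (M : Set H) := Submodule.isClosed_topologicalClosure _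
  have : CompleteSpace M := hMc.completeSpace_coe
  have hΦM : ∀ x, Φ x ∈ M := fun x =>
    Submodule.le_topologicalClosure _ (Submodule.subset_span ⟨x, rfl⟩)
  have hspan : ∀ u ∈ Submodule.span ℝ (Set.range Φ), Measurable fun x => inner ℝ u (Φ x) := by
    intro u hu
    induction hu using Submodule.span_induction with
    | mem u hu =>
      obtain ⟨x', rfl⟩ := hu
      exact hΦ x'
    | zero => simp
    | add u w _ _ hu hw =>
      simp_rw [inner_add_left]
      exact hu.add hw
    | smul r u _ hu =>
      simp_rw [inner_smul_left]
      exact hu.const_mul _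
  have hclos : ∀ u ∈ M, Measurable fun x => inner ℝ u (Φ x) := by
    intro u hu
    obtain ⟨s, hs, hlim⟩ := mem_closure_iff_seq_limit.1
      (show u ∈ closure (Submodule.span ℝ (Set.range Φ) : Set H) from hu)
    refine measurable_of_tendsto_metrizable (fun k => hspan (s k) (hs k))
      (tendsto_pi_nhds.2 fun x => ?_)
    exact hlim.inner tendsto_const_nhds
  have := hclos _ (M.starProjection_apply_mem h)
  convert! this using 2 with x
  have h0 : inner ℝ (h - M.starProjection h) (Φ x) = 0 :=
    M.starProjection_inner_eq_zero h (Φ x) (hΦM x)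
  rw [inner_sub_left] at h0
  linarith

theorem abs_label (y : Label) : |(y : ℝ)| = 1 := by
  rcases y.2 with h | h <;> simp [h]

theorem le_plusPart (t : ℝ) : t ≤ plusPart t := le_max_left _ _

theorem plusPart_nonneg (t : ℝ) : 0 ≤ plusPart t := le_max_right _ _

theorem plusPart_of_nonneg {t : ℝ} (h : 0 ≤ t) : plusPart t = t := max_eq_left h

theorem abs_plusPart_sub_le (s t : ℝ) : |plusPart s - plusPart t| ≤ |s - t| :=
  abs_max_sub_max_le_abs s t 0

theorem measurable_plusPart : Measurable plusPart := measurable_id.max measurable_const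

variable {X : Type*} {K : X → X → ℝ}

theorem abs_kernel_le [Fact (IsMercer K)] {b : ℝ} (hb : ∀ x, K x x ≤ b) (x x' : X) :
    |K x x'| ≤ b := by
  have hn : ∀ x, ‖featureMap K x‖ ^ 2 ≤ b := fun x => by
    rw [← real_inner_self_eq_norm_sq, inner_featureMap]
    exact hb x
  rw [← inner_featureMap K x x']
  refine (abs_real_inner_le_norm _ _).trans ?_
  nlinarith [hn x, hn x', sq_nonneg (‖featureMap K x‖ - ‖featureMap K x'‖)]

theorem norm_featureMap_le [Fact (IsMercer K)] {b : ℝ} (hb : ∀ x, K x x ≤ b) (x : X) :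
    ‖featureMap K x‖ ≤ Real.sqrt b := by
  refine Real.le_sqrt_of_sq_le ?_
  rw [← real_inner_self_eq_norm_sq, inner_featureMap]
  exact hb x

theorem abs_inner_featureMap_le [Fact (IsMercer K)] {b : ℝ} (hb : ∀ x, K x x ≤ b)
    (h : HilbertSpace K) (x : X) : |inner ℝ h (featureMap K x)| ≤ ‖h‖ * Real.sqrt b :=
  (abs_real_inner_le_norm _ _).trans
    (mul_le_mul_of_nonneg_left (norm_featureMap_le hb x) (norm_nonneg _))

theorem abs_label_mul_kernel_le {b : ℝ} (hb : ∀ x x', |K x x'| ≤ b) (z z' : X × Label) :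
    |(z.2 : ℝ) * z'.2 * K z.1 z'.1| ≤ b := by
  rw [abs_mul, abs_mul, abs_label, abs_label, one_mul, one_mul]
  exact hb _ _

theorem abs_label_mul_inner_le [Fact (IsMercer K)] {b : ℝ} (hb : ∀ x, K x x ≤ b)
    (h : HilbertSpace K) (z : X × Label) :
    |(z.2 : ℝ) * inner ℝ h (featureMap K z.1)| ≤ ‖h‖ * Real.sqrt b := by
  rw [abs_mul, abs_label, one_mul]
  exact abs_inner_featureMap_le hb h z.1

variable [MeasurableSpace X] {D : Measure (X × Label)} [IsProbabilityMeasure D]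

theorem measurable_inner_featureMap [Fact (IsMercer K)] (hK : Measurable (Function.uncurry K))
    (h : HilbertSpace K) : Measurable fun x => inner ℝ h (featureMap K x) :=
  measurable_inner_of_measurable_kernel (fun x' => by
    simp_rw [inner_featureMap]
    exact hK.comp measurable_prodMk_left) h

theorem measurable_label_mul_inner [Fact (IsMercer K)] (hK : Measurable (Function.uncurry K))
    (h : HilbertSpace K) :
    Measurable fun z : X × Label => (z.2 : ℝ) * inner ℝ h (featureMap K z.1) :=
  (measurable_subtype_coe.comp measurable_snd).mul
    ((measurable_inner_featureMap hK h).comp measurable_fst)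

theorem integrable_label_mul_inner [Fact (IsMercer K)] (hK : Measurable (Function.uncurry K))
    {b : ℝ} (hb : ∀ x, K x x ≤ b) (h : HilbertSpace K) :
    Integrable (fun z : X × Label => (z.2 : ℝ) * inner ℝ h (featureMap K z.1)) D :=
  Integrable.of_bound (measurable_label_mul_inner hK h).aestronglyMeasurable (‖h‖ * Real.sqrt b)
    (Filter.Eventually.of_forall (abs_label_mul_inner_le hb h))

theorem integrable_hinge [Fact (IsMercer K)] (hK : Measurable (Function.uncurry K))
    {b : ℝ} (hb : ∀ x, K x x ≤ b) (h : HilbertSpace K) (γ : ℝ) :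
    Integrable (fun z : X × Label => plusPart (1 - z.2 * inner ℝ h (featureMap K z.1) / γ)) D := by
  have hi : Integrable (fun z : X × Label =>
      1 - (z.2 : ℝ) * inner ℝ h (featureMap K z.1) / γ) D :=
    (integrable_const 1).sub ((integrable_label_mul_inner hK hb h).div_const γ)
  exact hi.pos_part

/-- Where the margin `γ` exceeds all values of `w`, the hinge loss is affine. -/
theorem integral_hinge_eq [Fact (IsMercer K)] (hK : Measurable (Function.uncurry K))
    {b : ℝ} (hb : ∀ x, K x x ≤ b) {w : HilbertSpace K} (hw : ‖w‖ = 1) {γ : ℝ} (hγ : 0 < γ)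
    (hbγ : Real.sqrt b ≤ γ) :
    ∫ z : X × Label, plusPart (1 - z.2 * inner ℝ w (featureMap K z.1) / γ) ∂D =
      1 - (∫ z : X × Label, (z.2 : ℝ) * inner ℝ w (featureMap K z.1) ∂D) / γ := by
  have e : ∀ z : X × Label, plusPart (1 - z.2 * inner ℝ w (featureMap K z.1) / γ) =
      1 - z.2 * inner ℝ w (featureMap K z.1) / γ := by
    intro z
    refine plusPart_of_nonneg ?_
    have := (le_abs_self _).trans (abs_label_mul_inner_le hb w z)
    rw [hw, one_mul] at this
    rw [sub_nonneg, div_le_one hγ]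
    exact this.trans hbγ
  simp_rw [e]
  rw [integral_sub (integrable_const _) ((integrable_label_mul_inner hK hb w).div_const γ),
    integral_div]
  simp

/-- At an error level of at least one, every kernel other than zero is good with arbitrarily large
margin. -/
theorem exists_kernelGood_of_one_le (hM : IsMercer K) (hK : Measurable (Function.uncurry K))
    {b : ℝ} (hb : ∀ x, K x x ≤ b) (hK0 : K ≠ 0) {ε : ℝ} (hε : 1 ≤ ε) (γ₀ : ℝ) :
    ∃ γ, γ₀ ≤ γ ∧ KernelGood D K ε γ := by
  have : Fact (IsMercer K) := ⟨hM⟩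
  obtain ⟨x, hx⟩ : ∃ x, featureMap K x ≠ 0 := by
    by_contra! h
    refine hK0 ?_
    funext x x'
    rw [← inner_featureMap K x x', h x, inner_zero_left]
    rfl
  set γ := max γ₀ (max (Real.sqrt b) 1) with hγ
  have hγ1 : 1 ≤ γ := (le_max_right _ _).trans (le_max_right _ _)
  have hγ0 : 0 < γ := by linarith
  have hbγ : Real.sqrt b ≤ γ := (le_max_left _ _).trans (le_max_right _ _)
  set w₁ : HilbertSpace K := ‖featureMap K x‖⁻¹ • featureMap K x with hw₁
  have hw₁n : ‖w₁‖ = 1 := by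
    rw [hw₁, norm_smul, norm_inv, norm_norm]
    exact inv_mul_cancel₀ (norm_ne_zero_iff.2 hx)
  -- of a unit vector and its negative, one has nonnegative correlation with the labels
  obtain ⟨w, hw, hpos⟩ : ∃ w : HilbertSpace K, ‖w‖ = 1 ∧
      0 ≤ ∫ z : X × Label, (z.2 : ℝ) * inner ℝ w (featureMap K z.1) ∂D := by
    rcases le_total 0 (∫ z : X × Label, (z.2 : ℝ) * inner ℝ w₁ (featureMap K z.1) ∂D) with h | h
    · exact ⟨w₁, hw₁n, h⟩
    · refine ⟨-w₁, by rw [norm_neg, hw₁n], ?_⟩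
      simp_rw [inner_neg_left, mul_neg]
      rw [integral_neg]
      linarith
  refine ⟨γ, le_max_left _ _, hM, w, hw, integrable_hinge hK hb w γ, ?_⟩
  rw [integral_hinge_eq hK hb hw hγ0 hbγ]
  have := div_nonneg hpos hγ0.le
  linarith

/-- The vector `w = E [y Φ(x)]`, obtained as a Riesz representative. -/
theorem exists_inner_eq_integral [Fact (IsMercer K)] (D : Measure (X × Label))
    [IsProbabilityMeasure D] (hK : Measurable (Function.uncurry K))
    {b : ℝ} (hb : ∀ x, K x x ≤ b) :
    ∃ w : HilbertSpace K, ∀ h : HilbertSpace K,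
      inner ℝ w h = ∫ z : X × Label, (z.2 : ℝ) * inner ℝ h (featureMap K z.1) ∂D := by
  have hi := fun h => integrable_label_mul_inner (D := D) hK hb h
  let L : HilbertSpace K →ₗ[ℝ] ℝ :=
    { toFun := fun h => ∫ z : X × Label, (z.2 : ℝ) * inner ℝ h (featureMap K z.1) ∂D
      map_add' := fun g h => by
        simp_rw [inner_add_left, mul_add]
        exact integral_add (hi g) (hi h)
      map_smul' := fun r h => by
        have e : ∀ z : X × Label, (z.2 : ℝ) * inner ℝ (r • h) (featureMap K z.1) =
            r * ((z.2 : ℝ) * inner ℝ h (featureMap K z.1)) := fun z => by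
          rw [real_inner_smul_left]
          ring
        simp_rw [e]
        exact integral_const_mul _ _ }
  have hL : ∀ h, ‖L h‖ ≤ Real.sqrt b * ‖h‖ := by
    intro h
    have := norm_integral_le_of_norm_le_const (μ := D)
      (f := fun z : X × Label => (z.2 : ℝ) * inner ℝ h (featureMap K z.1))
      (Filter.Eventually.of_forall (abs_label_mul_inner_le hb h))
    rw [mul_comm]
    refine this.trans (le_of_eq ?_)
    simp
  refine ⟨(InnerProductSpace.toDual ℝ (HilbertSpace K)).symm (L.mkContinuous _ hL), fun h => ?_⟩
  rw [InnerProductSpace.toDual_symm_apply]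
  rfl

theorem measurable_label_mul_kernel (hK : Measurable (Function.uncurry K)) :
    Measurable fun q : (X × Label) × (X × Label) => (q.1.2 : ℝ) * q.2.2 * K q.1.1 q.2.1 := by
  refine Measurable.mul (Measurable.mul ?_ ?_) ?_
  · exact measurable_subtype_coe.comp (measurable_snd.comp measurable_fst)
  · exact measurable_subtype_coe.comp (measurable_snd.comp measurable_snd)
  · exact hK.comp ((measurable_fst.comp measurable_fst).prodMk
      (measurable_fst.comp measurable_snd))

theorem integrable_label_mul_kernel (hK : Measurable (Function.uncurry K)) {b : ℝ}
    (hb : ∀ x x', |K x x'| ≤ b) : Integrable (fun q : (X × Label) × (X × Label) =>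
      (q.1.2 : ℝ) * q.2.2 * K q.1.1 q.2.1) (D.prod D) :=
  Integrable.of_bound (measurable_label_mul_kernel hK).aestronglyMeasurable b
    (Filter.Eventually.of_forall fun q => abs_label_mul_kernel_le hb q.1 q.2)

theorem integrable_pair_hinge (hK : Measurable (Function.uncurry K)) {b : ℝ}
    (hb : ∀ x x', |K x x'| ≤ b) : Integrable (fun q : (X × Label) × (X × Label) =>
      plusPart (1 - q.1.2 * q.2.2 * K q.1.1 q.2.1)) (D.prod D) :=
  ((integrable_const 1).sub (integrable_label_mul_kernel hK hb)).pos_part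

/-- A kernel of small pairwise hinge risk is good. The direction is that of `w = E [y Φ(x)]`, for
which the hinge loss at margin `1 / ‖w‖` is bounded by the risk, through Jensen's inequality. That
margin falls short of `γ₀` only if the kernel is so small that both hinge losses are affine; there
the margin `γ₀` itself is attained. -/
theorem exists_kernelGood_of_risk_le (hM : IsMercer K) (hK : Measurable (Function.uncurry K))
    {b : ℝ} (hb : ∀ x, K x x ≤ b) {ε : ℝ} (hε : ε < 1)
    (hrisk : ∫ q : (X × Label) × (X × Label),
      plusPart (1 - q.1.2 * q.2.2 * K q.1.1 q.2.1) ∂(D.prod D) ≤ ε)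
    {γ₀ : ℝ} (hγ₀ : 0 < γ₀) (hbγ : b * γ₀ ≤ 1) (hεγ : (1 - ε) * γ₀ ^ 2 ≤ 1) :
    ∃ γ, γ₀ ≤ γ ∧ KernelGood D K ε γ := by
  have : Fact (IsMercer K) := ⟨hM⟩
  have habs := abs_kernel_le hb
  have hiK := integrable_label_mul_kernel (D := D) hK habs
  have hiH := integrable_pair_hinge (D := D) hK habs
  obtain ⟨w₀, hw₀⟩ := exists_inner_eq_integral D hK hb
  -- the value of `w₀` at a labelled point
  have hval : ∀ z : X × Label, (z.2 : ℝ) * inner ℝ w₀ (featureMap K z.1) =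
      ∫ z' : X × Label, (z.2 : ℝ) * z'.2 * K z.1 z'.1 ∂D := by
    intro z
    rw [hw₀, ← integral_const_mul]
    refine integral_congr_ae (Filter.Eventually.of_forall fun z' => ?_)
    simp only [inner_featureMap]
    ring
  have hiz : ∀ z : X × Label,
      Integrable (fun z' : X × Label => (z.2 : ℝ) * z'.2 * K z.1 z'.1) D := fun z =>
    Integrable.of_bound
      ((measurable_label_mul_kernel hK).comp measurable_prodMk_left).aestronglyMeasurable b
      (Filter.Eventually.of_forall fun z' => abs_label_mul_kernel_le habs z z')
  have hnorm : ‖w₀‖ ^ 2 = ∫ q : (X × Label) × (X × Label),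
      (q.1.2 : ℝ) * q.2.2 * K q.1.1 q.2.1 ∂(D.prod D) := by
    rw [← real_inner_self_eq_norm_sq, hw₀, integral_prod _ hiK]
    exact integral_congr_ae (Filter.Eventually.of_forall hval)
  have hnormb : ‖w₀‖ ^ 2 ≤ b := by
    rw [hnorm]
    refine (integral_mono hiK (integrable_const b) fun q =>
      (le_abs_self _).trans (abs_label_mul_kernel_le habs q.1 q.2)).trans (le_of_eq ?_)
    simp
  have hjensen : ∫ z : X × Label, plusPart (1 - z.2 * inner ℝ w₀ (featureMap K z.1)) ∂D ≤ ε := by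
    refine le_trans ?_ hrisk
    rw [integral_prod _ hiH]
    refine integral_mono_of_nonneg (Filter.Eventually.of_forall fun z => plusPart_nonneg _)
      hiH.integral_prod_left (Filter.Eventually.of_forall fun z => ?_)
    have hih : Integrable (fun z' : X × Label =>
        plusPart (1 - (z.2 : ℝ) * z'.2 * K z.1 z'.1)) D :=
      ((integrable_const 1).sub (hiz z)).pos_part
    refine max_le ?_ (integral_nonneg fun z' => plusPart_nonneg _)
    rw [hval z]
    have e : 1 - ∫ z' : X × Label, (z.2 : ℝ) * z'.2 * K z.1 z'.1 ∂D =
        ∫ z' : X × Label, (1 - (z.2 : ℝ) * z'.2 * K z.1 z'.1) ∂D := by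
      rw [integral_sub (integrable_const _) (hiz z)]
      simp
    rw [e]
    exact integral_mono ((integrable_const 1).sub (hiz z)) hih fun z' => le_plusPart _
  have hw₀ne : w₀ ≠ 0 := by
    rintro rfl
    simp [plusPart] at hjensen
    linarith
  have hN : 0 < ‖w₀‖ := norm_pos_iff.2 hw₀ne
  set w : HilbertSpace K := ‖w₀‖⁻¹ • w₀ with hw
  have hwn : ‖w‖ = 1 := by
    rw [hw, norm_smul, norm_inv, norm_norm]
    exact inv_mul_cancel₀ hN.ne'
  have hwi : ∀ x, inner ℝ w (featureMap K x) = inner ℝ w₀ (featureMap K x) / ‖w₀‖ := by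
    intro x
    rw [hw, inner_smul_left]
    simp [div_eq_inv_mul]
  rcases le_or_gt γ₀ (1 / ‖w₀‖) with hle | hgt
  · refine ⟨1 / ‖w₀‖, hle, hM, w, hwn, integrable_hinge hK hb w _, le_trans (le_of_eq ?_) hjensen⟩
    refine integral_congr_ae (Filter.Eventually.of_forall fun z => ?_)
    simp only [hwi]
    congr 2
    field_simp
  · rw [div_lt_iff₀ hN] at hgt
    have hN1 : ‖w₀‖ < 1 := by nlinarith
    have hγ1 : 1 < γ₀ := by nlinarith
    have hb0 : 0 ≤ b := (sq_nonneg _).trans hnormb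
    have hb1 : b ≤ 1 := by nlinarith
    refine ⟨γ₀, le_rfl, hM, w, hwn, integrable_hinge hK hb w _, ?_⟩
    have haff : ∫ q : (X × Label) × (X × Label),
        plusPart (1 - q.1.2 * q.2.2 * K q.1.1 q.2.1) ∂(D.prod D) = 1 - ‖w₀‖ ^ 2 := by
      have e : ∀ q : (X × Label) × (X × Label), plusPart (1 - q.1.2 * q.2.2 * K q.1.1 q.2.1) =
          1 - q.1.2 * q.2.2 * K q.1.1 q.2.1 := fun q => plusPart_of_nonneg (by
        linarith [(le_abs_self _).trans (abs_label_mul_kernel_le habs q.1 q.2)])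
      simp_rw [e]
      rw [integral_sub (integrable_const _) hiK, ← hnorm]
      simp
    rw [haff] at hrisk
    have hcorr : ∫ z : X × Label, (z.2 : ℝ) * inner ℝ w (featureMap K z.1) ∂D = ‖w₀‖ := by
      rw [← hw₀ w, hw, inner_smul_right, real_inner_self_eq_norm_sq]
      field_simp
    rw [integral_hinge_eq hK hb hwn hγ₀ ((Real.sqrt_le_one.2 hb1).trans hγ1.le), hcorr]
    -- `(1 - ε) γ₀ ≤ ‖w₀‖`, since the squares satisfy `(1 - ε) ((1 - ε) γ₀ ^ 2) ≤ 1 - ε ≤ ‖w₀‖ ^ 2`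
    have hsq : ((1 - ε) * γ₀) ^ 2 ≤ ‖w₀‖ ^ 2 := by nlinarith
    have := le_of_sq_le_sq hsq hN.le
    have : 1 - ε ≤ ‖w₀‖ / γ₀ := by rwa [le_div_iff₀ hγ₀]
    linarith

end KernelGoodness

/-! ### Ridge-regularized minimization -/

section Minimizer

/-- A nonnegative, continuous, midpoint convex function has exactly one ridge-regularized minimizer
on a closed convex set. -/
theorem existsUnique_ridge_minimizer {E : Type*} [NormedAddCommGroup E] [InnerProductSpace ℝ E]
    [FiniteDimensional ℝ E] {A : Set E} (hA : IsClosed A) (hA0 : (0 : E) ∈ A)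
    (hAc : Convex ℝ A) {g : E → ℝ} (hg : Continuous g) (hg0 : ∀ x, 0 ≤ g x)
    (hgc : ∀ x y, g ((1 / 2 : ℝ) • (x + y)) ≤ (1 / 2) * (g x + g y)) {lam : ℝ} (hlam : 0 < lam) :
    ∃! x, x ∈ A ∧ ∀ y ∈ A, lam / 2 * ‖x‖ ^ 2 + g x ≤ lam / 2 * ‖y‖ ^ 2 + g y := by
  have : ProperSpace E := FiniteDimensional.proper ℝ E
  set r := Real.sqrt (2 * g 0 / lam) with hr
  have hcomp : IsCompact (A ∩ Metric.closedBall (0 : E) r) :=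
    (isCompact_closedBall (0 : E) r).inter_left hA
  have hmem0 : (0 : E) ∈ A ∩ Metric.closedBall (0 : E) r :=
    ⟨hA0, Metric.mem_closedBall_self (Real.sqrt_nonneg _)⟩
  obtain ⟨x, hx, hmin⟩ := hcomp.exists_isMinOn ⟨0, hmem0⟩
    (f := fun y => lam / 2 * ‖y‖ ^ 2 + g y) (by fun_prop)
  have hmin' : ∀ y ∈ A, lam / 2 * ‖x‖ ^ 2 + g x ≤ lam / 2 * ‖y‖ ^ 2 + g y := by
    intro y hy
    by_cases hyr : ‖y‖ ≤ r
    · exact hmin ⟨hy, mem_closedBall_zero_iff.2 hyr⟩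
    · -- outside of the ball the ridge term alone exceeds the value at the origin
      have h0 : lam / 2 * ‖x‖ ^ 2 + g x ≤ lam / 2 * ‖(0 : E)‖ ^ 2 + g 0 := hmin hmem0
      have h1 : 2 * g 0 / lam < ‖y‖ ^ 2 := Real.lt_sq_of_sqrt_lt (not_le.1 hyr)
      rw [div_lt_iff₀ hlam] at h1
      rw [norm_zero] at h0
      have := hg0 y
      linarith
  refine ⟨x, ⟨hx.1, hmin'⟩, ?_⟩
  rintro y ⟨hy, hymin⟩
  have hmid : (1 / 2 : ℝ) • (x + y) ∈ A := by
    rw [smul_add]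
    exact hAc hx.1 hy (by norm_num) (by norm_num) (by norm_num)
  have h1 := hmin' _ hmid
  have h2 := hymin _ hmid
  have h3 := hgc x y
  have h4 := parallelogram_law_with_norm ℝ x y
  have h5 : ‖(1 / 2 : ℝ) • (x + y)‖ = (1 / 2) * ‖x + y‖ := by
    rw [norm_smul]
    norm_num
  rw [h5] at h1 h2
  have h6 : lam / 8 * ‖x - y‖ ^ 2 ≤ 0 := by nlinarith
  have h7 : ‖x - y‖ ^ 2 ≤ 0 := by
    by_contra! h
    have : 0 < lam / 8 * ‖x - y‖ ^ 2 := by positivity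
    linarith
  have h8 : ‖x - y‖ = 0 := by
    have := sq_nonneg ‖x - y‖
    exact pow_eq_zero_iff (two_ne_zero) |>.1 (le_antisymm h7 this)
  exact (sub_eq_zero.1 (norm_eq_zero.1 h8)).symm

end Minimizer

/-! ### Risk and empirical risk of a combination -/

section EmpiricalRisk

variable {X : Type*} {p : ℕ} {K : Fin p → X → X → ℝ} {κ : Fin p → ℝ}

/-- The vector `(y y' K₁(x, x'), …, y y' K_p(x, x'))` of labelled kernel values. -/
def kernelVec (K : Fin p → X → X → ℝ) (q : (X × Label) × (X × Label)) :
    EuclideanSpace ℝ (Fin p) :=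
  WithLp.toLp 2 fun i => q.1.2 * q.2.2 * K i q.1.1 q.2.1

theorem inner_kernelVec (K : Fin p → X → X → ℝ) (μ : EuclideanSpace ℝ (Fin p))
    (q : (X × Label) × (X × Label)) :
    inner ℝ μ (kernelVec K q) = q.1.2 * q.2.2 * combination K μ q.1.1 q.2.1 := by
  rw [PiLp.inner_apply, combination, Finset.mul_sum]
  refine Finset.sum_congr rfl fun i _ => ?_
  simp only [kernelVec, RCLike.inner_apply, conj_trivial]
  ring

theorem pairLoss_eq (K : Fin p → X → X → ℝ) (μ : EuclideanSpace ℝ (Fin p))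
    (z z' : X × Label) : pairLoss K μ z z' = plusPart (1 - inner ℝ μ (kernelVec K (z, z'))) := by
  rw [inner_kernelVec]
  rfl

theorem pairLoss_nonneg (K : Fin p → X → X → ℝ) (μ : EuclideanSpace ℝ (Fin p))
    (z z' : X × Label) : 0 ≤ pairLoss K μ z z' := plusPart_nonneg _

theorem pairLoss_zero (K : Fin p → X → X → ℝ) (z z' : X × Label) : pairLoss K 0 z z' = 1 := by
  rw [pairLoss_eq, inner_zero_left, sub_zero]
  exact plusPart_of_nonneg zero_le_one

theorem pairLoss_comm (hK : ∀ i, IsMercer (K i)) (μ : EuclideanSpace ℝ (Fin p))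
    (z z' : X × Label) : pairLoss K μ z z' = pairLoss K μ z' z := by
  have h : combination K μ z.1 z'.1 = combination K μ z'.1 z.1 :=
    Finset.sum_congr rfl fun i _ => by
      have := (hK i).1.apply z.1 z'.1
      simp only [Matrix.of_apply, star_trivial] at this
      rw [this]
  rw [pairLoss, pairLoss, h, mul_comm (z.2 : ℝ)]

theorem abs_pairLoss_sub_le (K : Fin p → X → X → ℝ) (μ ν : EuclideanSpace ℝ (Fin p))
    (q : (X × Label) × (X × Label)) : |pairLoss K μ q.1 q.2 - pairLoss K ν q.1 q.2| ≤
      |inner ℝ μ (kernelVec K q) - inner ℝ ν (kernelVec K q)| := by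
  rw [pairLoss_eq, pairLoss_eq]
  refine (abs_plusPart_sub_le _ _).trans (le_of_eq ?_)
  rw [abs_sub_comm]
  congr 1
  ring

theorem continuous_pairLoss (K : Fin p → X → X → ℝ) (z z' : X × Label) :
    Continuous fun μ => pairLoss K μ z z' := by
  simp_rw [pairLoss_eq, plusPart]
  fun_prop

theorem pairLoss_midpoint_le (K : Fin p → X → X → ℝ) (μ ν : EuclideanSpace ℝ (Fin p))
    (z z' : X × Label) : pairLoss K ((1 / 2 : ℝ) • (μ + ν)) z z' ≤
      (1 / 2) * (pairLoss K μ z z' + pairLoss K ν z z') := by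
  have h1 := pairLoss_nonneg K μ z z'
  have h2 := pairLoss_nonneg K ν z z'
  rw [pairLoss_eq] at h1 h2
  have h3 := le_plusPart (1 - inner ℝ μ (kernelVec K (z, z')))
  have h4 := le_plusPart (1 - inner ℝ ν (kernelVec K (z, z')))
  rw [pairLoss_eq, pairLoss_eq, pairLoss_eq]
  refine max_le ?_ (by linarith)
  rw [real_inner_smul_left, inner_add_left]
  linarith

theorem pair_coeff_nonneg (n : ℕ) : (0 : ℝ) ≤ 2 / ((n : ℝ) * ((n : ℝ) - 1)) := by
  rcases n with _ | n
  · simp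
  · push_cast
    rw [add_sub_cancel_right]
    positivity

theorem empiricalRisk_nonneg {n : ℕ} (K : Fin p → X → X → ℝ) (S : Fin n → X × Label)
    (μ : EuclideanSpace ℝ (Fin p)) : 0 ≤ empiricalRisk K S μ :=
  mul_nonneg (pair_coeff_nonneg n)
    (Finset.sum_nonneg fun _ _ => Finset.sum_nonneg fun _ _ => pairLoss_nonneg _ _ _ _)

theorem continuous_empiricalRisk {n : ℕ} (K : Fin p → X → X → ℝ) (S : Fin n → X × Label) :
    Continuous (empiricalRisk K S) :=
  continuous_const.mul (continuous_finsetSum _ fun _ _ => continuous_finsetSum _ fun _ _ =>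
    continuous_pairLoss K _ _)

theorem empiricalRisk_midpoint_le {n : ℕ} (K : Fin p → X → X → ℝ) (S : Fin n → X × Label)
    (μ ν : EuclideanSpace ℝ (Fin p)) : empiricalRisk K S ((1 / 2 : ℝ) • (μ + ν)) ≤
      (1 / 2) * (empiricalRisk K S μ + empiricalRisk K S ν) := by
  unfold empiricalRisk
  rw [← mul_add, mul_left_comm]
  refine mul_le_mul_of_nonneg_left ?_ (pair_coeff_nonneg n)
  rw [← Finset.sum_add_distrib, Finset.mul_sum]
  refine Finset.sum_le_sum fun i _ => ?_
  rw [← Finset.sum_add_distrib, Finset.mul_sum]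
  exact Finset.sum_le_sum fun j _ => pairLoss_midpoint_le K μ ν _ _

theorem existsUnique_isLearned {n : ℕ} (K : Fin p → X → X → ℝ) {lam : ℝ} (hlam : 0 < lam)
    (S : Fin n → X × Label) : ∃! μ, IsLearned K lam S μ := by
  have hcont : ∀ i, Continuous fun μ : EuclideanSpace ℝ (Fin p) => μ i := fun i => by fun_prop
  refine existsUnique_ridge_minimizer (A := {μ : EuclideanSpace ℝ (Fin p) | ∀ i, 0 ≤ μ i})
    ?_ (by simp) ?_ (continuous_empiricalRisk K S) (empiricalRisk_nonneg K S)
    (empiricalRisk_midpoint_le K S) hlam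
  · rw [Set.ofPred_forall]
    exact isClosed_iInter fun i => isClosed_le continuous_const (hcont i)
  · intro μ hμ ν hν a b ha hb _ i
    simpa using add_nonneg (mul_nonneg ha (hμ i)) (mul_nonneg hb (hν i))

theorem isMercer_combination (hK : ∀ i, IsMercer (K i)) {μ : EuclideanSpace ℝ (Fin p)}
    (hμ : ∀ i, 0 ≤ μ i) : IsMercer (combination K μ) := by
  have h : Matrix.of (combination K μ) = ∑ i, μ i • Matrix.of (K i) := by
    ext x x'
    simp [combination, Matrix.sum_apply]
  rw [IsMercer, h]
  exact Matrix.posSemidef_sum _ fun i _ => (hK i).smul (hμ i)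

theorem norm_kernelVec_le (hK : ∀ i, IsMercer (K i)) (hκ : ∀ i x x', K i x x' ≤ κ i ^ 2)
    (q : (X × Label) × (X × Label)) : ‖kernelVec K q‖ ≤ ‖boundVec κ‖ := by
  rw [EuclideanSpace.norm_eq, EuclideanSpace.norm_eq]
  refine Real.sqrt_le_sqrt (Finset.sum_le_sum fun i _ =>
    pow_le_pow_left₀ (norm_nonneg _) ?_ 2)
  have : Fact (IsMercer (K i)) := ⟨hK i⟩
  simp only [kernelVec, boundVec, Real.norm_eq_abs]
  exact (abs_label_mul_kernel_le (abs_kernel_le fun x => hκ i x x) q.1 q.2).trans (le_abs_self _)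

theorem abs_inner_kernelVec_le (hK : ∀ i, IsMercer (K i)) (hκ : ∀ i x x', K i x x' ≤ κ i ^ 2)
    (μ : EuclideanSpace ℝ (Fin p)) (q : (X × Label) × (X × Label)) :
    |inner ℝ μ (kernelVec K q)| ≤ ‖μ‖ * ‖boundVec κ‖ :=
  (abs_real_inner_le_norm _ _).trans
    (mul_le_mul_of_nonneg_left (norm_kernelVec_le hK hκ q) (norm_nonneg _))

theorem combination_diag_le (hK : ∀ i, IsMercer (K i)) (hκ : ∀ i x x', K i x x' ≤ κ i ^ 2)
    (μ : EuclideanSpace ℝ (Fin p)) (x : X) :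
    combination K μ x x ≤ ‖μ‖ * ‖boundVec κ‖ := by
  have := (le_abs_self _).trans
    (abs_inner_kernelVec_le hK hκ μ ((x, ⟨1, Or.inl rfl⟩), (x, ⟨1, Or.inl rfl⟩)))
  rw [inner_kernelVec] at this
  simpa using this

/-- The empirical risk as a mean over arrangements of the sample into pairs. -/
theorem permMean_pairLoss (hK : ∀ i, IsMercer (K i)) {n m : ℕ} (hm : 0 < m) {a b : Fin m → Fin n}
    (hab : ∀ i, a i ≠ b i) (S : Fin n → X × Label) (μ : EuclideanSpace ℝ (Fin p)) :
    permMean a b (fun q => pairLoss K μ q.1 q.2) S = empiricalRisk K S μ :=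
  (pair_mean_eq_perm_mean hm (fun i j => pairLoss K μ (S i) (S j))
    (fun _ _ => pairLoss_comm hK μ _ _) hab).symm

variable [MeasurableSpace X]

theorem measurable_combination (hK : ∀ i, Measurable (Function.uncurry (K i)))
    (μ : EuclideanSpace ℝ (Fin p)) : Measurable (Function.uncurry (combination K μ)) := by
  change Measurable fun q : X × X => ∑ i, μ i * Function.uncurry (K i) q
  exact Finset.measurable_sum _ fun i _ => (hK i).const_mul (μ i)

theorem measurable_inner_kernelVec (hK : ∀ i, Measurable (Function.uncurry (K i)))
    (μ : EuclideanSpace ℝ (Fin p)) : Measurable fun q => inner ℝ μ (kernelVec K q) := by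
  simp_rw [inner_kernelVec]
  exact measurable_label_mul_kernel (measurable_combination hK μ)

theorem measurable_pairLoss (hK : ∀ i, Measurable (Function.uncurry (K i)))
    (μ : EuclideanSpace ℝ (Fin p)) :
    Measurable fun q : (X × Label) × (X × Label) => pairLoss K μ q.1 q.2 := by
  simp_rw [pairLoss_eq]
  exact measurable_plusPart.comp ((measurable_inner_kernelVec hK μ).const_sub 1)

theorem integrable_pairLoss (D : Measure (X × Label)) [IsProbabilityMeasure D]
    (hM : ∀ i, IsMercer (K i)) (hK : ∀ i, Measurable (Function.uncurry (K i)))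
    (hκ : ∀ i x x', K i x x' ≤ κ i ^ 2) (μ : EuclideanSpace ℝ (Fin p)) :
    Integrable (fun q : (X × Label) × (X × Label) => pairLoss K μ q.1 q.2) (D.prod D) := by
  refine Integrable.of_bound (measurable_pairLoss hK μ).aestronglyMeasurable
    (1 + ‖μ‖ * ‖boundVec κ‖) (Filter.Eventually.of_forall fun q => ?_)
  have h := (abs_pairLoss_sub_le K μ 0 q)
  rw [pairLoss_zero, inner_zero_left, sub_zero] at h
  have h2 := h.trans (abs_inner_kernelVec_le hM hκ μ q)
  rw [Real.norm_eq_abs, abs_of_nonneg (pairLoss_nonneg _ _ _ _)]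
  linarith [(abs_le.1 h2).2]

theorem one_sub_le_risk (D : Measure (X × Label)) [IsProbabilityMeasure D]
    (hM : ∀ i, IsMercer (K i)) (hK : ∀ i, Measurable (Function.uncurry (K i)))
    (hκ : ∀ i x x', K i x x' ≤ κ i ^ 2) (μ : EuclideanSpace ℝ (Fin p)) :
    1 - ‖μ‖ * ‖boundVec κ‖ ≤ risk D K μ := by
  have h := integral_mono (integrable_const (1 - ‖μ‖ * ‖boundVec κ‖))
    (integrable_pairLoss D hM hK hκ μ) fun q => by
      have h1 := le_plusPart (1 - inner ℝ μ (kernelVec K (q.1, q.2)))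
      have h2 := (le_abs_self _).trans (abs_inner_kernelVec_le hM hκ μ (q.1, q.2))
      change _ ≤ pairLoss K μ q.1 q.2
      rw [pairLoss_eq]
      linarith
  simpa [risk] using h

theorem risk_nonneg (D : Measure (X × Label)) (K : Fin p → X → X → ℝ)
    (μ : EuclideanSpace ℝ (Fin p)) : 0 ≤ risk D K μ :=
  integral_nonneg fun _ => pairLoss_nonneg _ _ _ _

/-- Uniform convergence of the empirical risk on a ball, in both directions. -/
theorem exists_measurableSet_risk_deviation (D : Measure (X × Label)) [IsProbabilityMeasure D]
    (hM : ∀ i, IsMercer (K i)) (hK : ∀ i, Measurable (Function.uncurry (K i)))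
    (hκ : ∀ i x x', K i x x' ≤ κ i ^ 2) (hκ0 : 0 < ‖boundVec κ‖) {B : ℝ} (hB : 0 < B)
    {n : ℕ} (hn : 2 ≤ n) {r : ℝ} (hr : 0 ≤ r) :
    ∃ N : Set (Fin n → X × Label), MeasurableSet N ∧
      (Measure.pi fun _ => D) N ≤
        ENNReal.ofReal (4 * Real.exp (-(n * r ^ 2 / (24 * (B * ‖boundVec κ‖) ^ 2)))) ∧
      ∀ S ∉ N, ∀ μ, ‖μ‖ ≤ B → |risk D K μ - empiricalRisk K S μ| ≤ r := by
  set m := n / 2 with hm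
  have hm0 : 0 < m := by omega
  -- `n / 2 ≥ n / 3` for the integer quotient, as `n ≥ 2`
  have hmn : (n : ℝ) / 3 ≤ m := by
    have : n ≤ 3 * m := by omega
    have : (n : ℝ) ≤ 3 * m := by exact_mod_cast this
    linarith
  let a : Fin m → Fin n := fun i => ⟨i, by omega⟩
  let b : Fin m → Fin n := fun i => ⟨m + i, by omega⟩
  have hne : ∀ i j, a i ≠ b j := fun i j h => by
    have := Fin.val_eq_of_eq h
    simp only [a, b] at this
    omega
  have hab : Function.Injective (Sum.elim a b) := by
    refine Function.Injective.sumElim ?_ ?_ hne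
    · intro i j h
      have := Fin.val_eq_of_eq h
      simp only [a] at this
      exact Fin.ext this
    · intro i j h
      have := Fin.val_eq_of_eq h
      simp only [b] at this
      exact Fin.ext (by omega)
  have hlip0 : ∀ μ q, |pairLoss K μ q.1 q.2 - 1| ≤ |inner ℝ μ (kernelVec K q)| := fun μ q => by
    have h := abs_pairLoss_sub_le K μ 0 q
    rwa [pairLoss_zero, inner_zero_left, sub_zero] at h
  have hmeas := measurable_inner_kernelVec hK
  have hperm := fun (S : Fin n → X × Label) μ =>
    permMean_pairLoss hM hm0 (fun i => hne i i) S μ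
  have hint := integrable_pairLoss D hM hK hκ
  obtain ⟨N₁, hN₁, hP₁, hD₁⟩ := exists_measurableSet_permMean_deviation D
    (f := fun μ q => pairLoss K μ q.1 q.2 - 1) (v := kernelVec K) hB hκ0
    (norm_kernelVec_le hM hκ) (fun μ => (measurable_pairLoss hK μ).sub_const 1) hmeas hlip0
    (fun μ ν q => by
      rw [sub_sub_sub_cancel_right]
      exact abs_pairLoss_sub_le K μ ν q) hm0 hab hr
  obtain ⟨N₂, hN₂, hP₂, hD₂⟩ := exists_measurableSet_permMean_deviation D
    (f := fun μ q => 1 - pairLoss K μ q.1 q.2) (v := kernelVec K) hB hκ0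
    (norm_kernelVec_le hM hκ) (fun μ => (measurable_pairLoss hK μ).const_sub 1) hmeas
    (fun μ q => by
      rw [abs_sub_comm]
      exact hlip0 μ q)
    (fun μ ν q => by
      rw [sub_sub_sub_cancel_left, abs_sub_comm]
      exact abs_pairLoss_sub_le K μ ν q) hm0 hab hr
  have hexp : 2 * Real.exp (-(m * r ^ 2 / (8 * (B * ‖boundVec κ‖) ^ 2))) ≤
      2 * Real.exp (-(n * r ^ 2 / (24 * (B * ‖boundVec κ‖) ^ 2))) := by
    refine mul_le_mul_of_nonneg_left (Real.exp_le_exp.2 (neg_le_neg ?_)) zero_le_two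
    rw [div_le_div_iff₀ (by positivity) (by positivity)]
    have h1 : (0 : ℝ) ≤ r ^ 2 * (24 * (B * ‖boundVec κ‖) ^ 2) := by positivity
    have := mul_le_mul_of_nonneg_right hmn h1
    linarith
  refine ⟨N₁ ∪ N₂, hN₁.union hN₂, ?_, fun S hS μ hμ => ?_⟩
  · refine (measure_union_le _ _).trans ((add_le_add hP₁ hP₂).trans ?_)
    rw [← ENNReal.ofReal_add (by positivity) (by positivity)]
    exact ENNReal.ofReal_le_ofReal (by linarith)
  · have h1 := hD₁ S (fun h => hS (Or.inl h)) μ hμ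
    have h2 := hD₂ S (fun h => hS (Or.inr h)) μ hμ
    rw [permMean_sub, permMean_const hm0, hperm] at h1 h2
    rw [integral_sub (hint μ) (integrable_const _)] at h1
    rw [integral_sub (integrable_const _) (hint μ)] at h2
    simp only [integral_const, probReal_univ, smul_eq_mul, mul_one] at h1 h2
    rw [abs_le, risk]
    constructor <;> linarith

end EmpiricalRisk

/-! ### The oracle inequality -/

section OracleInequality

variable {X : Type*} {p : ℕ} {K : Fin p → X → X → ℝ}

theorem IsLearned.norm_sq_le {n : ℕ} {lam : ℝ} (hlam : 0 < lam) {S : Fin n → X × Label}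
    {μ : EuclideanSpace ℝ (Fin p)} (hμ : IsLearned K lam S μ) :
    ‖μ‖ ^ 2 ≤ 2 * empiricalRisk K S 0 / lam := by
  have h := hμ.2 0 fun i => le_rfl
  have h0 := empiricalRisk_nonneg K S μ
  simp only [objective, norm_zero] at h
  rw [le_div_iff₀ hlam]
  linarith

/-- The empirical risk of the zero vector is one; for samples of size at most one it is zero. -/
theorem empiricalRisk_zero_le (n : ℕ) (K : Fin p → X → X → ℝ) (S : Fin n → X × Label) :
    empiricalRisk K S 0 ≤ 1 := by
  have hcard : ∑ i : Fin n, ∑ j : Fin n with i < j, (1 : ℝ) = (1 / 2) * (n * (n - 1)) := by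
    rw [sum_lt_eq_half_sum_offDiag (fun _ _ => 1) fun _ _ => rfl, Finset.sum_const,
      Finset.offDiag_card, Finset.card_univ, Fintype.card_fin, nsmul_eq_mul,
      Nat.cast_sub (Nat.le_mul_self n)]
    push_cast
    ring
  simp only [empiricalRisk, pairLoss_zero]
  rw [hcard, show 2 / ((n : ℝ) * (n - 1)) * (1 / 2 * (n * (n - 1))) =
    ((n : ℝ) * (n - 1)) / (n * (n - 1)) by ring]
  exact div_self_le_one _

variable [MeasurableSpace X]

/-- On a sample without large deviations, the risk of the learned combination exceeds that of the
reference `μo` by at most its ridge penalty and two deviations. -/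
theorem IsLearned.risk_le {D : Measure (X × Label)} {n : ℕ} {lam r B : ℝ} {S : Fin n → X × Label}
    {μ μo : EuclideanSpace ℝ (Fin p)} (hlam : 0 < lam) (hμ : IsLearned K lam S μ)
    (hμo : ∀ i, 0 ≤ μo i) (hμB : ‖μ‖ ≤ B) (hμoB : ‖μo‖ ≤ B)
    (hS : ∀ ν, ‖ν‖ ≤ B → |risk D K ν - empiricalRisk K S ν| ≤ r) :
    risk D K μ ≤ risk D K μo + lam / 2 * ‖μo‖ ^ 2 + 2 * r := by
  have h1 := (abs_le.1 (hS μ hμB)).2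
  have h2 := (abs_le.1 (hS μo hμoB)).1
  have h3 := hμ.2 μo hμo
  have h4 : 0 ≤ lam / 2 * ‖μ‖ ^ 2 := by positivity
  simp only [objective] at h3
  linarith

end OracleInequality
end TwoStageMKL

open TwoStageMKL in
theorem mainTheorem3 (δ₀ : ℝ) (hδ₀ : 0 < δ₀) (hδ₀' : δ₀ < 1) :
    ∃ C : ℝ, 0 < C ∧
      ∀ (X : Type*) [MeasurableSpace X] (D : Measure (X × TwoStageMKL.Label))
        [IsProbabilityMeasure D] (p : ℕ) (K : Fin p → X → X → ℝ) (κ : Fin p → ℝ),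
        (∀ i, TwoStageMKL.IsMercer (K i)) →
        (∀ i, Measurable (Function.uncurry (K i))) →
        (∀ i, 0 < κ i) →
        (∀ i x x', K i x x' ≤ κ i ^ 2) →
        ∀ (μo : EuclideanSpace ℝ (Fin p)) (εo ε₁ δ : ℝ) (n : ℕ),
          (∀ i, 0 ≤ μo i) → μo ≠ 0 →
          TwoStageMKL.CombinationGood D K μo εo →
          0 < ε₁ → 0 < δ → δ ≤ δ₀ →
          C * (‖μo‖ ^ 2 * ‖TwoStageMKL.boundVec κ‖ ^ 2 * Real.log (1 / δ) / ε₁ ^ 3) ≤ n →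
          (∀ S : Fin n → X × TwoStageMKL.Label,
            ∃! μ, TwoStageMKL.IsLearned K (2 * ε₁ / (3 * ‖μo‖ ^ 2)) S μ) ∧
          ∃ G : Set (Fin n → X × TwoStageMKL.Label), MeasurableSet G ∧
            ENNReal.ofReal (1 - δ) ≤ Measure.pi (fun _ : Fin n => D) G ∧
            ∀ S ∈ G, ∀ μ, TwoStageMKL.IsLearned K (2 * ε₁ / (3 * ‖μo‖ ^ 2)) S μ →
              -- a kernel that vanishes identically has no unit vector in its Hilbert space; this
              -- has to be excluded only where the error level `εo + ε₁` is trivial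
              (εo + ε₁ < 1 ∨ TwoStageMKL.combination K μ ≠ 0) →
              ∃ γ : ℝ,
                Real.sqrt (ε₁ / 3) / (‖TwoStageMKL.boundVec κ‖ * ‖μo‖) ≤ γ ∧
                TwoStageMKL.KernelGood D (TwoStageMKL.combination K μ) (εo + ε₁) γ := by
  have hL₀ : 0 < Real.log (1 / δ₀) := Real.log_pos (by rwa [lt_div_iff₀ hδ₀, one_mul])
  -- `648 = 3 * 24 * 9` collects the constants of the deviation bound at `r = ε₁ / 3` with
  -- `B ^ 2 = 3 * ‖μo‖ ^ 2 / ε₁`; the summand `2 / log (1 / δ₀)` absorbs the factor `4` of that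
  -- bound
  refine ⟨648 * (1 + 2 / Real.log (1 / δ₀)), by positivity, ?_⟩
  intro X _ D _ p K κ hM hK hκpos hκ μo εo ε₁ δ n hμo hμo0 hgood hε₁ hδ hδδ₀ hn
  have hR : 0 < ‖μo‖ := norm_pos_iff.2 hμo0
  have hk : 0 < ‖boundVec κ‖ := by
    rw [norm_pos_iff]
    intro h
    refine hμo0 ?_
    ext i
    have := congrArg (fun v : EuclideanSpace ℝ (Fin p) => v i) h
    simp only [boundVec, PiLp.zero_apply] at this
    exact absurd this (pow_pos (hκpos i) 2).ne'
  have hlam : 0 < 2 * ε₁ / (3 * ‖μo‖ ^ 2) := by positivity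
  refine ⟨existsUnique_isLearned K hlam, ?_⟩
  rcases le_or_gt 1 (εo + ε₁) with hlevel | hlevel
  · refine ⟨Set.univ, MeasurableSet.univ, ?_, fun S _ μ hμ hne => ?_⟩
    · rw [measure_univ]
      exact ENNReal.ofReal_le_one.2 (by linarith)
    · exact exists_kernelGood_of_one_le (isMercer_combination hM hμ.1)
        (measurable_combination hK μ) (combination_diag_le hM hκ μ)
        (hne.resolve_left (not_lt.2 hlevel)) hlevel _
  have hriskle : risk D K μo ≤ εo := hgood
  have hrisk0 := risk_nonneg D K μo
  have hrisk1 := one_sub_le_risk D hM hK hκ μo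
  set P : ℝ := ‖μo‖ * ‖boundVec κ‖ with hP
  have hPpos : 0 < P := mul_pos hR hk
  have hεP : ε₁ < P := by linarith
  have hε1 : ε₁ < 1 := by linarith
  -- the radius of a ball that holds the learned combination
  set q : ℝ := Real.sqrt (ε₁ / 3) with hq
  have hqpos : 0 < q := Real.sqrt_pos.2 (by positivity)
  have hqsq : q ^ 2 = ε₁ / 3 := Real.sq_sqrt (by positivity)
  have hq1 : q ≤ 1 := Real.sqrt_le_one.2 (by linarith)
  set B : ℝ := ‖μo‖ / q with hB
  have hBpos : 0 < B := by positivity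
  have hμoB : ‖μo‖ ≤ B := by
    rw [hB, le_div_iff₀ hqpos]
    exact mul_le_of_le_one_right hR.le hq1
  have hBsq : B ^ 2 = 3 * ‖μo‖ ^ 2 / ε₁ := by
    rw [hB, div_pow, hqsq]
    field_simp
  have hBk : (B * ‖boundVec κ‖) ^ 2 = 3 * P ^ 2 / ε₁ := by
    rw [mul_pow, hBsq, hP]
    ring
  -- the sample size in terms of `t = P ^ 2 / ε₁ ^ 3`, which exceeds one
  set l : ℝ := Real.log (1 / δ) with hl
  have hL₀l : Real.log (1 / δ₀) ≤ l :=
    Real.log_le_log (by positivity) (one_div_le_one_div_of_le hδ hδδ₀)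
  have hlpos : 0 < l := hL₀.trans_le hL₀l
  have hl2 : l + 2 ≤ (1 + 2 / Real.log (1 / δ₀)) * l := by
    have : 2 ≤ 2 / Real.log (1 / δ₀) * l := by
      rw [div_mul_eq_mul_div, le_div_iff₀ hL₀]
      linarith
    linarith
  set t : ℝ := P ^ 2 / ε₁ ^ 3 with ht
  have ht1 : 1 ≤ t := by
    rw [ht, le_div_iff₀ (by positivity)]
    calc 1 * ε₁ ^ 3 = ε₁ ^ 2 * ε₁ := by ring
      _ ≤ ε₁ ^ 2 * 1 := mul_le_mul_of_nonneg_left hε1.le (sq_nonneg _)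
      _ ≤ P ^ 2 := by
        rw [mul_one]
        exact pow_le_pow_left₀ hε₁.le hεP.le 2
  have htpos : 0 < t := by linarith
  have hnt : 648 * (l + 2) * t ≤ n := by
    refine le_trans ?_ hn
    have e : 648 * (1 + 2 / Real.log (1 / δ₀)) *
        (‖μo‖ ^ 2 * ‖boundVec κ‖ ^ 2 * l / ε₁ ^ 3) =
        648 * ((1 + 2 / Real.log (1 / δ₀)) * l) * t := by
      rw [ht, hP]
      ring
    rw [e]
    exact mul_le_mul_of_nonneg_right (by linarith) htpos.le
  have hn2 : 2 ≤ n := by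
    have h1 : 648 * (l + 2) * 1 ≤ 648 * (l + 2) * t :=
      mul_le_mul_of_nonneg_left ht1 (by linarith)
    have h2 : (2 : ℝ) ≤ n := by linarith
    exact_mod_cast h2
  obtain ⟨N, hN, hNP, hND⟩ := exists_measurableSet_risk_deviation D hM hK hκ hk hBpos hn2
    (r := ε₁ / 3) (by positivity)
  have hprob : 4 * Real.exp (-(n * (ε₁ / 3) ^ 2 / (24 * (B * ‖boundVec κ‖) ^ 2))) ≤ δ := by
    have e : n * (ε₁ / 3) ^ 2 / (24 * (B * ‖boundVec κ‖) ^ 2) = n / (648 * t) := by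
      rw [hBk, ht]
      field_simp
      norm_num
    have h1 : l + 2 ≤ n / (648 * t) := by
      rw [le_div_iff₀ (by positivity)]
      linarith
    have h2 : Real.exp (-(l + 2)) = δ * Real.exp (-2) := by
      rw [neg_add, Real.exp_add, hl, one_div, Real.log_inv, neg_neg, Real.exp_log hδ]
    have h3 : 4 * Real.exp (-2) ≤ 1 := by
      have h4 : (2 : ℝ) ≤ Real.exp 1 := by linarith [Real.add_one_le_exp (1 : ℝ)]
      have h5 : Real.exp 2 = Real.exp 1 * Real.exp 1 := by
        rw [← Real.exp_add]
        norm_num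
      rw [Real.exp_neg, ← div_eq_mul_inv, div_le_one (Real.exp_pos _), h5]
      nlinarith
    rw [e]
    calc 4 * Real.exp (-(n / (648 * t))) ≤ 4 * Real.exp (-(l + 2)) :=
          mul_le_mul_of_nonneg_left (Real.exp_le_exp.2 (by linarith)) (by norm_num)
      _ = δ * (4 * Real.exp (-2)) := by rw [h2]; ring
      _ ≤ δ := mul_le_of_le_one_right hδ.le h3
  refine ⟨Nᶜ, hN.compl, ?_, fun S hS μ hμ _ => ?_⟩
  · rw [prob_compl_eq_one_sub hN, ENNReal.ofReal_sub _ hδ.le, ENNReal.ofReal_one]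
    exact tsub_le_tsub_left (hNP.trans (ENNReal.ofReal_le_ofReal hprob)) 1
  · have hμB : ‖μ‖ ≤ B := by
      refine le_of_sq_le_sq ?_ hBpos.le
      refine (hμ.norm_sq_le hlam).trans ?_
      rw [hBsq, div_le_iff₀ hlam, show 3 * ‖μo‖ ^ 2 / ε₁ * (2 * ε₁ / (3 * ‖μo‖ ^ 2)) = 2 by
        field_simp]
      linarith [empiricalRisk_zero_le n K S]
    have hrisk : risk D K μ ≤ εo + ε₁ := by
      refine (hμ.risk_le hlam hμo hμB hμoB (hND S hS)).trans ?_
      rw [show 2 * ε₁ / (3 * ‖μo‖ ^ 2) / 2 * ‖μo‖ ^ 2 = ε₁ / 3 by field_simp]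
      linarith
    refine exists_kernelGood_of_risk_le (b := B * ‖boundVec κ‖) (isMercer_combination hM hμ.1)
      (measurable_combination hK μ) (fun x => (combination_diag_le hM hκ μ x).trans
        (mul_le_mul_of_nonneg_right hμB hk.le)) hlevel hrisk (by positivity) (le_of_eq ?_) ?_
    · rw [hB]
      field_simp
    · -- `1 - (εo + ε₁) ≤ P - ε₁ ≤ P` and `ε₁ ≤ P`
      rw [div_pow, hqsq, mul_comm ‖boundVec κ‖, ← hP, ← mul_div_assoc,
        div_le_one (by positivity)]
      have h1 : (1 - (εo + ε₁)) * (ε₁ / 3) ≤ P * (P / 3) :=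
        mul_le_mul (by linarith) (by linarith) (by positivity) hPpos.le
      nlinarith [sq_nonneg P]
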